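/- **Setting.** Let $d\ge 1$, let $\mathcal X\subset\mathbf R^d$ be convex and compact, and let $\Theta\subset\mathbf R^q$ be compact and such that, for some constants $c,\delta>0$, any two points $a,b\in\Theta$ with $|a-b|\le\delta$ can be joined inside $\Theta$ by a curve of length at most $c|a-b|$ (for instance, $\Theta$ convex). Let $\Phi$ be a kernel on $\mathcal X\times\mathcal X$ that is conditionally positive definite with respect to a finite-dimensional space $\mathcal P$ of functions on $\mathcal X$. Its native space $\mathcal N$ consists of the functions $f$ on $\mathcal X$ for which there is a constant $C\ge 0$ with $$\Big|\sum_k a_k f(s_k)\Big|\le C\Big(\sum_{k,l}a_ka_l\Phi(s_k,s_l)\Big)^{1/2}$$ for all finite sums with $\sum_k a_kp(s_k)=0$ for every $p\in\mathcal P$; the native semi-norm $\|f\|_{\mathcal N}$ is the least such $C$. For $\boldsymbol f=(f_1,\dots,f_q)$ let $\|\boldsymbol f\|_{\mathcal N}=(\sum_j\|f_j\|_{\mathcal N}^2)^{1/2}$ and $\|\boldsymbol f\|_{L_2(\mathcal X)}=(\sum_j\|f_j\|^2_{L_2(\mathcal X)})^{1/2}$, and let $\mathcal N^\Theta$ be the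 set of $\boldsymbol f=(f_1,\dots,f_q)$ with all $f_j\in\mathcal N$ and $\boldsymbol f(x)\in\Theta$ for all $x\in\mathcal X$. Let $\zeta:\mathcal X\to\mathbf R^r$ be a bounded function (the physical response), let $y^s$ (the computer model) and $\hat y^s_n$, $n\ge1$ (the emulators), be functions from $\mathcal X\times\Theta$ to $\mathbf R^r$, and fix $\nu>d/2$. **Assumptions.** 1′. For each $n\ge 1$ the design points $x_1,\dots,x_n\in\mathcal X$ (which may depend on $n$) are deterministic and, with $\|f\|_n=(n^{-1}\sum_{i=1}^n f(x_i)^2)^{1/2}$, $$\|f\|_{L_2(\mathcal X)}\le C_0\big(\|f\|_n+n^{-\nu/(2\nu+d)}\|f\|_{\mathcal N}\big)\quad\text{for all } f\in\mathcal N,$$ with $C_0$ independent of $n$ and $f$. One observes $y_i^p=\zeta(x_i)+e_i$, $i=1,\dots,n$, where the random vectors $e_1,\dots,e_n$ are independent with mean zero and sub-Gaussian with a common parameter $\sigma>0$, i.e. $E\exp(\alpha^Te_i)\le\exp(\sigma^2|\alpha|^2/2)$ for all $\alpha\in\mathbf R^r$. 2. $y^s\in C^2(\mathcal X\times\Theta)$.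 3. There is $C>0$ such that, for all $\epsilon,\rho>0$, the $\epsilon$-covering number of $\{f\in\mathcal N:\|f\|_{\mathcal N}\le\rho\}$ in the supremum norm satisfies $\log N\le(C\rho/\epsilon)^{d/\nu}$. 4. The $\hat y^s_n$ are $C^1$ on $\mathcal X\times\Theta$, and $\|\hat y^s_n-y^s\|_{C^1(\mathcal X\times\Theta)}=O(n^{-\nu/(2\nu+d)})$, where the $C^1$ norm is the supremum of the absolute values of all components and of all their first-order partial derivatives. 5. The optimal calibration function $\theta^*\in\mathcal N^\Theta$ exists: $\theta^*(x)$ minimizes $|\zeta(x)-y^s(x,\cdot)|^2$ over $\Theta$ for every $x\in\mathcal X$, and for some $\omega_0>0$, $$|\zeta(x)-y^s(x,\theta)|^2-|\zeta(x)-y^s(x,\theta^*(x))|^2\ge\omega_0|\theta-\theta^*(x)|^2\quad\text{for all }\theta\in\Theta,\ x\in\mathcal X.$$ 6. $\lambda_n>0$ is a deterministic sequence with $\lambda_n=O(n^{-2\nu/(2\nu+d)})$ and $\lambda_n^{-1}=O(n^{2\nu/(2\nu+d)})$. **Conclusion.** Let $\hat\theta_n$ be, almost surely, a minimizer over $\theta\in\mathcal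 N^\Theta$ of $$\frac1n\sum_{i=1}^n\big|y_i^p-\hat y^s_n(x_i,\theta(x_i))\big|^2+\lambda_n\sum_{j=1}^q\|\theta_j\|_{\mathcal N}^2 .$$ Then $$\|\hat\theta_n-\theta^*\|_{L_2(\mathcal X)}=O_p\big(n^{-\nu/(2\nu+d)}\big)\qquad\text{and}\qquad\|\hat\theta_n\|_{\mathcal N}=O_p(1).$$ -/

import Mathlib

open MeasureTheory ProbabilityTheory Filter
open scoped ENNReal

namespace FunCalib

noncomputable section

/-! ## Native spaces of conditionally positive definite kernels -/

/-- The value `∑ a_s f(s)` on `f` of the finitely supported functional `∑ a_s δ_s`. -/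
def pairing {S : Type*} (c : S →₀ ℝ) (f : S → ℝ) : ℝ :=
  c.sum fun s a => a * f s

/-- The quadratic form `∑ a_s a_t Φ(s,t)` of the kernel `Φ` at `∑ a_s δ_s`. -/
def quadForm {S : Type*} (Φ : S → S → ℝ) (c : S →₀ ℝ) : ℝ :=
  c.sum fun s a => c.sum fun t b => a * b * Φ s t

/-- The functional `∑ a_s δ_s` vanishes on every function in `P`. -/
def Annihilates {S : Type*} (P : Submodule ℝ (S → ℝ)) (c : S →₀ ℝ) : Prop :=
  ∀ p ∈ P, pairing c p = 0

/-- `Φ` is a symmetric kernel, conditionally positive definite with respect to the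
finite-dimensional function space `P`. The inequality is not required to be strict, so that
strictly conditionally positive definite kernels are a special case; `P = ⊥` gives the
(unconditionally) positive definite kernels. -/
structure IsCondPosDef {S : Type*} (Φ : S → S → ℝ) (P : Submodule ℝ (S → ℝ)) : Prop where
  finiteDimensional : FiniteDimensional ℝ P
  symm : ∀ s t, Φ s t = Φ t s
  nonneg : ∀ c : S →₀ ℝ, Annihilates P c → 0 ≤ quadForm Φ c

/-- `|c(f)| ≤ C ‖c‖_Φ` for all finitely supported functionals `c` vanishing on `P`, where
`‖c‖_Φ` is the square root of the quadratic form of `Φ` at `c`. -/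
def NativeBound {S : Type*} (Φ : S → S → ℝ) (P : Submodule ℝ (S → ℝ)) (f : S → ℝ)
    (C : ℝ) : Prop :=
  0 ≤ C ∧ ∀ c : S →₀ ℝ, Annihilates P c → |pairing c f| ≤ C * Real.sqrt (quadForm Φ c)

/-- The native space of `Φ` (with respect to `P`): the functions on which all functionals
vanishing on `P` are bounded with respect to `‖·‖_Φ`. For `P = ⊥` this is the reproducing
kernel Hilbert space of `Φ`. -/
def nativeSpace {S : Type*} (Φ : S → S → ℝ) (P : Submodule ℝ (S → ℝ)) : Set (S → ℝ) :=
  {f | ∃ C, NativeBound Φ P f C}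

/-- The native semi-norm: the least constant `C` with `|c(f)| ≤ C ‖c‖_Φ`. It is only used for
members of the native space. -/
def nativeNorm {S : Type*} (Φ : S → S → ℝ) (P : Submodule ℝ (S → ℝ)) (f : S → ℝ) : ℝ :=
  sInf {C | NativeBound Φ P f C}

/-- The ball `{f ∈ 𝒩 : ‖f‖_𝒩 ≤ ρ}`. -/
def nativeBall {S : Type*} (Φ : S → S → ℝ) (P : Submodule ℝ (S → ℝ)) (ρ : ℝ) :
    Set (S → ℝ) :=
  {f | f ∈ nativeSpace Φ P ∧ nativeNorm Φ P f ≤ ρ}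

/-- The Euclidean norm of `(‖f_1‖_𝒩, …, ‖f_q‖_𝒩)`, for a vector-valued function. -/
def nativeNormVec {S : Type*} {q : ℕ} (Φ : S → S → ℝ) (P : Submodule ℝ (S → ℝ))
    (f : S → EuclideanSpace ℝ (Fin q)) : ℝ :=
  Real.sqrt (∑ j, nativeNorm Φ P (fun s => f s j) ^ 2)

/-- The set `𝒩^Θ` of vector-valued functions with components in the native space and values
in `Θ`. -/
def nativeSpaceIn {S : Type*} {q : ℕ} (Φ : S → S → ℝ) (P : Submodule ℝ (S → ℝ))
    (Θ : Set (EuclideanSpace ℝ (Fin q))) : Set (S → EuclideanSpace ℝ (Fin q)) :=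
  {f | (∀ j, (fun s => f s j) ∈ nativeSpace Φ P) ∧ ∀ s, f s ∈ Θ}

/-! ## Covering numbers in the supremum norm -/

/-- `A` is covered by `N` closed balls of radius `δ` for the supremum norm. -/
def CoveredBy {S : Type*} (δ : ℝ) (A : Set (S → ℝ)) (N : ℕ) : Prop :=
  ∃ g : Fin N → S → ℝ, ∀ f ∈ A, ∃ j, ∀ s, |f s - g j s| ≤ δ

/-- The covering number of `A` for the supremum norm (`⊤` if there is no finite cover). -/
def coveringNumber {S : Type*} (δ : ℝ) (A : Set (S → ℝ)) : ℕ∞ :=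
  ⨅ (N : ℕ) (_ : CoveredBy δ A N), (N : ℕ∞)

/-! ## Norms -/

/-- The empirical semi-norm `(n⁻¹ ∑ f(x_i)²)^{1/2}` of a design `x_1, …, x_n`. -/
def empNorm {S : Type*} {n : ℕ} (x : Fin n → S) (f : S → ℝ) : ℝ :=
  Real.sqrt ((∑ i, f (x i) ^ 2) / n)

/-- The `L₂` norm of a function on `X ⊆ ℝ^d` for Lebesgue measure, with values in `[0,∞]`. -/
def l2Norm {d : ℕ} {X : Set (EuclideanSpace ℝ (Fin d))} (f : X → ℝ) : ℝ≥0∞ :=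
  (∫⁻ x : X, ‖f x‖ₑ ^ 2 ∂(volume.comap (Subtype.val : X → EuclideanSpace ℝ (Fin d)))) ^
    (1 / 2 : ℝ)

/-- The `L₂` norm `(∑ ‖f_j‖²)^{1/2}` of a vector-valued function. -/
def l2NormVec {d q : ℕ} {X : Set (EuclideanSpace ℝ (Fin d))}
    (f : X → EuclideanSpace ℝ (Fin q)) : ℝ≥0∞ :=
  (∑ j, l2Norm (fun x => f x j) ^ 2) ^ (1 / 2 : ℝ)

/-- The `C¹` norm on `Γ ⊆ ℝ^d × ℝ^q`: the supremum over `Γ` of the absolute values of the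
components of `g` and of their first order partial derivatives (taken within `Γ`). -/
def c1Norm {d q r : ℕ} (Γ : Set (EuclideanSpace ℝ (Fin d) × EuclideanSpace ℝ (Fin q)))
    (g : EuclideanSpace ℝ (Fin d) × EuclideanSpace ℝ (Fin q) → EuclideanSpace ℝ (Fin r)) :
    ℝ≥0∞ :=
  ⨆ p ∈ Γ, ⨆ k : Fin r,
    max ‖g p k‖ₑ
      (max (⨆ j : Fin d, ‖fderivWithin ℝ g Γ p (EuclideanSpace.single j 1, 0) k‖ₑ)
        (⨆ j : Fin q, ‖fderivWithin ℝ g Γ p (0, EuclideanSpace.single j 1) k‖ₑ))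

/-! ## Geometry of the parameter set -/

/-- Any two sufficiently close points `a, b` of `Θ` are joined inside `Θ` by a rectifiable
curve of length at most `c |a - b|`. Every convex set has this property (with segments). -/
def LocallyQuasiconvex {q : ℕ} (Θ : Set (EuclideanSpace ℝ (Fin q))) : Prop :=
  ∃ c δ : ℝ, 0 < δ ∧ ∀ a ∈ Θ, ∀ b ∈ Θ, dist a b ≤ δ →
    ∃ γ : ℝ → EuclideanSpace ℝ (Fin q), γ 0 = a ∧ γ 1 = b ∧
      (∀ t ∈ Set.Icc (0 : ℝ) 1, γ t ∈ Θ) ∧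
      ∀ s ∈ Set.Icc (0 : ℝ) 1, ∀ t ∈ Set.Icc (0 : ℝ) 1,
        dist (γ s) (γ t) ≤ c * dist a b * |s - t|

/-! ## Probability -/

/-- The random vector `ξ` is sub-Gaussian with parameter `σ`. -/
structure IsSubGaussian {Ω : Type*} [MeasurableSpace Ω] {r : ℕ}
    (ξ : Ω → EuclideanSpace ℝ (Fin r)) (σ : ℝ) (μ : Measure Ω) : Prop where
  integrable : Integrable ξ μ
  integrable_exp : ∀ α : EuclideanSpace ℝ (Fin r),
    Integrable (fun ω => Real.exp (inner ℝ α (ξ ω - ∫ ω', ξ ω' ∂μ))) μ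
  bound : ∀ α : EuclideanSpace ℝ (Fin r),
    ∫ ω, Real.exp (inner ℝ α (ξ ω - ∫ ω', ξ ω' ∂μ)) ∂μ ≤ Real.exp (σ ^ 2 * ‖α‖ ^ 2 / 2)

/-- `Z_n = O_p(a_n)`. The sets need not be measurable: `μ` is then the outer measure. -/
def IsBigOp {Ω : Type*} [MeasurableSpace Ω] (μ : Measure Ω) (Z : ℕ → Ω → ℝ≥0∞)
    (a : ℕ → ℝ) : Prop :=
  ∀ ε : ℝ, 0 < ε → ∃ C : ℝ, 0 < C ∧
    ∀ᶠ n in atTop, μ {ω | ENNReal.ofReal (C * a n) < Z n ω} ≤ ENNReal.ofReal ε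

/-! ## The conditions and the estimator -/

/-- Deterministic designs `x_{n,1}, …, x_{n,n}` with
`‖f‖_{L₂} ≲ ‖f‖_n + n^{-ν/(2ν+d)} ‖f‖_𝒩` uniformly in `f ∈ 𝒩` and `n ≥ 1`. -/
def DesignCondition {d : ℕ} {X : Set (EuclideanSpace ℝ (Fin d))} (Φ : X → X → ℝ)
    (P : Submodule ℝ (X → ℝ)) (ν : ℝ) (x : (n : ℕ) → Fin n → X) : Prop :=
  ∃ C : ℝ, ∀ n : ℕ, 1 ≤ n → ∀ f ∈ nativeSpace Φ P,
    l2Norm f ≤ ENNReal.ofReal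
      (C * (empNorm (x n) f + (n : ℝ) ^ (-(ν / (2 * ν + d))) * nativeNorm Φ P f))

/-- For each `n` the noise vectors `e_{n,1}, …, e_{n,n}` are independent, with mean zero, and
sub-Gaussian with the common parameter `σ`. -/
structure NoiseCondition {Ω : Type*} [MeasurableSpace Ω] {r : ℕ} (μ : Measure Ω) (σ : ℝ)
    (e : (n : ℕ) → Fin n → Ω → EuclideanSpace ℝ (Fin r)) : Prop where
  measurable : ∀ n i, Measurable (e n i)
  indep : ∀ n, iIndepFun (e n) μ
  mean_zero : ∀ n i, ∫ ω, e n i ω ∂μ = 0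
  subGaussian : ∀ n i, IsSubGaussian (e n i) σ μ

/-- The entropy bound `log N(ε, {f ∈ 𝒩 : ‖f‖_𝒩 ≤ ρ}, L_∞) ≤ (Cρ/ε)^{d/ν}`. -/
def EntropyCondition {S : Type*} (Φ : S → S → ℝ) (P : Submodule ℝ (S → ℝ)) (d : ℕ)
    (ν : ℝ) : Prop :=
  ∃ C : ℝ, 0 < C ∧ ∀ ε ρ : ℝ, 0 < ε → 0 < ρ →
    ∃ N : ℕ, coveringNumber ε (nativeBall Φ P ρ) = N ∧
      Real.log N ≤ (C * ρ / ε) ^ ((d : ℝ) / ν)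

/-- The emulators are `C¹` on `Γ` and `‖ŷ_n - y‖_{C¹(Γ)} = O(n^{-ν/(2ν+d)})`. -/
def EmulatorCondition {d q r : ℕ}
    (Γ : Set (EuclideanSpace ℝ (Fin d) × EuclideanSpace ℝ (Fin q))) (ν : ℝ)
    (y : EuclideanSpace ℝ (Fin d) × EuclideanSpace ℝ (Fin q) → EuclideanSpace ℝ (Fin r))
    (yhat : ℕ → EuclideanSpace ℝ (Fin d) × EuclideanSpace ℝ (Fin q) →
      EuclideanSpace ℝ (Fin r)) : Prop :=
  (∀ n, ContDiffOn ℝ 1 (yhat n) Γ) ∧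
  ∃ C : ℝ, ∀ᶠ n : ℕ in atTop,
    c1Norm Γ (fun p => yhat n p - y p) ≤
      ENNReal.ofReal (C * (n : ℝ) ^ (-(ν / (2 * ν + d))))

/-- `θ*` is the optimal calibration function: `θ*(x)` minimizes `|ζ(x) - y(x,·)|²` over `Θ` for
every `x`, and it does so with a quadratic margin that is uniform in `x`. -/
def IdentifiabilityCondition {d q r : ℕ} {X : Set (EuclideanSpace ℝ (Fin d))}
    (Θ : Set (EuclideanSpace ℝ (Fin q))) (ζ : X → EuclideanSpace ℝ (Fin r))
    (y : EuclideanSpace ℝ (Fin d) × EuclideanSpace ℝ (Fin q) → EuclideanSpace ℝ (Fin r))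
    (θstar : X → EuclideanSpace ℝ (Fin q)) : Prop :=
  (∀ x : X, θstar x ∈ Θ ∧ IsMinOn (fun t => ‖ζ x - y (x, t)‖ ^ 2) Θ (θstar x)) ∧
  ∃ ω₀ : ℝ, 0 < ω₀ ∧ ∀ t ∈ Θ, ∀ x : X,
    ω₀ * ‖t - θstar x‖ ^ 2 ≤ ‖ζ x - y (x, t)‖ ^ 2 - ‖ζ x - y (x, θstar x)‖ ^ 2

/-- The penalized least squares criterion
`n⁻¹ ∑ |z_i - ŷ(x_i, θ(x_i))|² + lam ∑ ‖θ_j‖_𝒩²` for observations `z_1, …, z_n`. -/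
def criterion {d q r n : ℕ} {X : Set (EuclideanSpace ℝ (Fin d))} (Φ : X → X → ℝ)
    (P : Submodule ℝ (X → ℝ)) (x : Fin n → X) (z : Fin n → EuclideanSpace ℝ (Fin r))
    (yhat : EuclideanSpace ℝ (Fin d) × EuclideanSpace ℝ (Fin q) → EuclideanSpace ℝ (Fin r))
    (lam : ℝ) (θ : X → EuclideanSpace ℝ (Fin q)) : ℝ :=
  (1 / (n : ℝ)) * ∑ i, ‖z i - yhat (x i, θ (x i))‖ ^ 2
    + lam * ∑ j, nativeNorm Φ P (fun s => θ s j) ^ 2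

/-- `θ` is a minimizer of the criterion over `𝒩^Θ`. -/
def IsEstimate {d q r n : ℕ} {X : Set (EuclideanSpace ℝ (Fin d))} (Φ : X → X → ℝ)
    (P : Submodule ℝ (X → ℝ)) (Θ : Set (EuclideanSpace ℝ (Fin q))) (x : Fin n → X)
    (z : Fin n → EuclideanSpace ℝ (Fin r))
    (yhat : EuclideanSpace ℝ (Fin d) × EuclideanSpace ℝ (Fin q) → EuclideanSpace ℝ (Fin r))
    (lam : ℝ) (θ : X → EuclideanSpace ℝ (Fin q)) : Prop :=
  θ ∈ nativeSpaceIn Φ P Θ ∧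
    IsMinOn (criterion Φ P x z yhat lam) (nativeSpaceIn Φ P Θ) θ

end

end FunCalib

/-! Write a = n^{-ν/(2ν+d)}, H = n a², s² = ∑ |θ̂(x_i) - θ*(x_i)|² and R = ‖θ̂‖_𝒩. Comparing the
criterion at θ̂ and at θ* gives, by the identifiability margin, ω₀ s² + nλ R² ≤ nλ ‖θ*‖²_𝒩 + O(√n a
s) + 2 |noise term| (`basic_inequality`). The emulator error costs only √n a s: the emulator minus
the model is O(a) and is Lipschitz in the parameter with constant O(a) (`bounds_of_c1Norm_le`), so
every error term in the excess loss is at most a multiple of a times the increment of θ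
(`excess_loss_ge`). Since nλ is of exact order H, dividing by H leaves a quadratic inequality in
s/√H and R with coefficients independent of n.

The noise term has to be controlled at a random θ, hence uniformly. `exists_event_process` bounds it
by K m^{3/2} H for all θ with R ≤ m and s ≤ m √H, off one event of small probability. The process is
linear in sub-Gaussian noise, so it can be chained. For radius m, the sup-norm entropy at resolution
m a 2^{-k} is of order (2^k/a)^{d/ν} = 2^{kd/ν} H, by the balance n a² = a^{-d/ν}; it does not
depend on m. As d/ν < 2, the links of a chain sum geometrically. Raising the thresholds by √m makes
the failure probabilities summable over dyadic shells m ~ 2^j. The price m^{3/2} is of lower order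
than m², so s/√H and R stay bounded (`exists_bound_of_quadratic`).

The design condition, applied to the components of θ̂ - θ*, then turns the bounds on s and R into
the L₂ rate (`l2NormVec_sub_le`). -/

namespace FunCalib

open Set Topology

/-! ### Mean value inequality along curves -/

section Curves

variable {E F : Type*} [NormedAddCommGroup E] [NormedSpace ℝ E] [NormedAddCommGroup F]
  [NormedSpace ℝ F]

/-- Mean value inequality along a Lipschitz curve. -/
lemma norm_image_sub_le_of_curve {f : E → F} {f' : ℝ → E →L[ℝ] F} {s : Set E} {K l : ℝ}
    {γ : ℝ → E} (hl : 0 ≤ l)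
    (hγ : ∀ u ∈ Icc (0 : ℝ) 1, ∀ t ∈ Icc (0 : ℝ) 1, dist (γ u) (γ t) ≤ l * |u - t|)
    (hs : ∀ t ∈ Icc (0 : ℝ) 1, γ t ∈ s)
    (hf : ∀ t ∈ Icc (0 : ℝ) 1, HasFDerivWithinAt f (f' t) s (γ t))
    (hK : ∀ t ∈ Icc (0 : ℝ) 1, ‖f' t‖ ≤ K) : ‖f (γ 1) - f (γ 0)‖ ≤ K * l := by
  have hγc : ContinuousOn γ (Icc 0 1) := by
    have : LipschitzOnWith ⟨l, hl⟩ γ (Icc 0 1) :=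
      LipschitzOnWith.of_dist_le_mul fun u hu t ht => by
        rw [Real.dist_eq]
        exact hγ u hu t ht
    exact this.continuousOn
  have hK0 : 0 ≤ K := (norm_nonneg _).trans (hK 0 (by simp))
  -- The curve need not be differentiable, so there is no chain rule. Instead the right slopes of ‖f
  -- (γ t) - f (γ 0)‖ are compared with the slope R of a linear barrier; the comparison needs a
  -- strict inequality, hence R > K l.
  refine le_of_forall_gt_imp_ge_of_dense fun R hR => ?_
  have key := image_norm_le_of_liminf_right_slope_norm_lt_deriv_boundary
    (f := fun t => f (γ t) - f (γ 0)) (f' := fun _ => K * l) (a := 0) (b := 1)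
    (B := fun t => R * t) (B' := fun _ => R) ?_ ?_ ?_ ?_ ?_ ?_ (x := 1) (by simp)
  · simpa using key
  · refine ContinuousOn.sub ?_ continuousOn_const
    intro t ht
    exact ((hf t ht).continuousWithinAt).comp (hγc t ht) hs
  · intro t ht r hr
    have htI : t ∈ Icc (0 : ℝ) 1 := ⟨ht.1, ht.2.le⟩
    obtain ⟨c, hc, hcr⟩ : ∃ c : ℝ, 0 < c ∧ (K + c) * l < r := by
      -- The summand 1 in the denominator covers l = 0.
      refine ⟨(r - K * l) / (2 * (l + 1)), by have : 0 < r - K * l := by linarith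
                                              positivity, ?_⟩
      have h1 : (r - K * l) / (2 * (l + 1)) * l ≤ (r - K * l) / 2 := by
        rw [div_mul_eq_mul_div, div_le_div_iff₀ (by positivity) (by positivity)]
        nlinarith
      nlinarith
    have h1 := (hasFDerivWithinAt_iff_isLittleO.1 (hf t htI)).def hc
    have htend : Tendsto γ (𝓝[>] t) (𝓝[s] (γ t)) := by
      have hI : Icc (0 : ℝ) 1 ∈ 𝓝[>] t :=
        mem_of_superset (Ioc_mem_nhdsGT ht.2) fun z hz => ⟨ht.1.trans hz.1.le, hz.2⟩
      refine tendsto_nhdsWithin_of_tendsto_nhds_of_eventually_within _ ?_ ?_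
      · exact (hγc t htI).tendsto.mono_left (le_inf (nhdsWithin_le_nhds) (le_principal_iff.2 hI))
      · exact mem_of_superset hI hs
    have h2 := htend.eventually h1
    refine Eventually.frequently ?_
    filter_upwards [h2, Ioc_mem_nhdsGT ht.2] with z hz hzI
    have hzI' : z ∈ Icc (0 : ℝ) 1 := ⟨ht.1.trans hzI.1.le, hzI.2⟩
    have hpos : 0 < z - t := sub_pos.2 hzI.1
    have hd : ‖γ z - γ t‖ ≤ l * (z - t) := by
      have := hγ z hzI' t htI
      rwa [dist_eq_norm, abs_of_pos hpos] at this
    have hn : ‖f (γ z) - f (γ t)‖ ≤ (K + c) * l * (z - t) := by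
      calc ‖f (γ z) - f (γ t)‖
          ≤ ‖f (γ z) - f (γ t) - f' t (γ z - γ t)‖ + ‖f' t (γ z - γ t)‖ := by
            simpa using norm_add_le (f (γ z) - f (γ t) - f' t (γ z - γ t)) (f' t (γ z - γ t))
        _ ≤ c * ‖γ z - γ t‖ + K * ‖γ z - γ t‖ := by
            refine add_le_add hz (((f' t).le_opNorm _).trans ?_)
            exact mul_le_mul_of_nonneg_right (hK t htI) (norm_nonneg _)
        _ = (K + c) * ‖γ z - γ t‖ := by ring
        _ ≤ (K + c) * (l * (z - t)) := by gcongr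
        _ = _ := by ring
    rw [slope_def_field, div_lt_iff₀ hpos]
    have h3 : ‖f (γ z) - f (γ 0)‖ - ‖f (γ t) - f (γ 0)‖ ≤ ‖f (γ z) - f (γ t)‖ := by
      simpa using norm_sub_norm_le (f (γ z) - f (γ 0)) (f (γ t) - f (γ 0))
    have h4 : (K + c) * l * (z - t) < r * (z - t) := mul_lt_mul_of_pos_right hcr hpos
    simp only [Function.comp]
    linarith
  · simp
  · fun_prop
  · intro t _
    simpa using ((hasDerivAt_id t).const_mul R).hasDerivWithinAt
  · intro t _ _
    exact hR

end Curves

/-! ### Coordinate bounds in Euclidean space -/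

section Euclid

variable {q r : ℕ}

lemma norm_le_mul_of_coord_le {w : EuclideanSpace ℝ (Fin q)} {B : ℝ} (hw : ∀ k, |w k| ≤ B) :
    ‖w‖ ≤ q * B := by
  have h : w = ∑ k, w k • EuclideanSpace.single k (1 : ℝ) := by
    ext i
    simp [Finset.sum_apply, Pi.single_apply]
  calc ‖w‖ = ‖∑ k, w k • EuclideanSpace.single k (1 : ℝ)‖ := by rw [← h]
    _ ≤ ∑ k, ‖w k • EuclideanSpace.single k (1 : ℝ)‖ := norm_sum_le _ _
    _ ≤ ∑ _k : Fin q, B := by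
        refine Finset.sum_le_sum fun k _ => ?_
        simpa [norm_smul] using hw k
    _ = q * B := by simp

lemma abs_coord_le_norm (w : EuclideanSpace ℝ (Fin q)) (k : Fin q) : |w k| ≤ ‖w‖ := by
  simpa using PiLp.norm_apply_le w k

lemma opNorm_le_of_coord_le {A : EuclideanSpace ℝ (Fin q) →L[ℝ] EuclideanSpace ℝ (Fin r)}
    {B : ℝ} (hB : 0 ≤ B) (hA : ∀ j k, |A (EuclideanSpace.single j 1) k| ≤ B) :
    ‖A‖ ≤ q * (r * B) := by
  refine A.opNorm_le_bound (by positivity) fun v => ?_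
  have h : v = ∑ k, v k • EuclideanSpace.single k (1 : ℝ) := by
    ext i
    simp [Finset.sum_apply, Pi.single_apply]
  calc ‖A v‖ = ‖∑ k, v k • A (EuclideanSpace.single k (1 : ℝ))‖ := by
        conv_lhs => rw [h]
        simp only [map_sum, map_smul]
    _ ≤ ∑ k, ‖v k • A (EuclideanSpace.single k (1 : ℝ))‖ := norm_sum_le _ _
    _ ≤ ∑ _k : Fin q, ‖v‖ * (r * B) := by
        refine Finset.sum_le_sum fun k _ => ?_
        rw [norm_smul]
        exact mul_le_mul (abs_coord_le_norm v k) (norm_le_mul_of_coord_le (hA k))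
          (norm_nonneg _) (norm_nonneg _)
    _ = q * (r * B) * ‖v‖ := by simp; ring

end Euclid

/-! ### Lipschitz bounds on X × Θ from C¹ regularity -/

section Lipschitz

variable {d q r : ℕ} {X : Set (EuclideanSpace ℝ (Fin d))} {Θ : Set (EuclideanSpace ℝ (Fin q))}

/-- On `X × Θ`, with `X` convex and `Θ` locally quasiconvex, continuously differentiable
functions are locally Lipschitz. -/
lemma locallyLipschitzOn_of_contDiffOn (hX : Convex ℝ X) (hΘ : LocallyQuasiconvex Θ)
    {y : EuclideanSpace ℝ (Fin d) × EuclideanSpace ℝ (Fin q) → EuclideanSpace ℝ (Fin r)}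
    (hy : ContDiffOn ℝ 1 y (X ×ˢ Θ)) : LocallyLipschitzOn (X ×ˢ Θ) y := by
  obtain ⟨c, δ, hδ, hc⟩ := hΘ
  intro p hp
  have hyp := hy p hp
  -- X × Θ may lack unique derivatives, so `fderivWithin` need not be continuous. The local
  -- derivative supplied by the definition of C¹ is continuous at p and therefore bounded near p.
  rw [show (1 : WithTop ℕ∞) = 0 + 1 by simp,
    contDiffWithinAt_succ_iff_hasFDerivWithinAt' (by simp)] at hyp
  obtain ⟨u, hu, -, -, f', hf', hcont⟩ := hyp
  rw [insert_eq_of_mem hp] at hu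
  have hcont' : ContinuousWithinAt f' (X ×ˢ Θ) p := hcont.continuousWithinAt
  have hn : {z | ‖f' z‖ < ‖f' p‖ + 1} ∈ 𝓝[X ×ˢ Θ] p :=
    hcont'.norm.eventually (gt_mem_nhds (lt_add_one _))
  obtain ⟨ε, hε, hball⟩ := Metric.mem_nhdsWithin_iff.1 (inter_mem hu hn)
  set c' := max c 1 with hc'
  have hc1 : 1 ≤ c' := le_max_right _ _
  -- Points within η of p are less than 2η ≤ δ apart, so their parameters can be joined. The joining
  -- path has length at most 2c'η and starts within η of p; as c' ≥ 1, it stays in the ball of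
  -- radius 4c'η ≤ ε.
  set η := min (δ / 2) (ε / (4 * c')) with hη
  have hη0 : 0 < η := by positivity
  have hηε : 4 * c' * η ≤ ε := by
    have : η ≤ ε / (4 * c') := min_le_right _ _
    rw [le_div_iff₀ (by positivity)] at this
    linarith
  refine ⟨⟨(‖f' p‖ + 1) * c', by positivity⟩, Metric.ball p η ∩ X ×ˢ Θ,
    inter_mem (mem_nhdsWithin_of_mem_nhds (Metric.ball_mem_nhds p hη0)) self_mem_nhdsWithin, ?_⟩
  refine LipschitzOnWith.of_dist_le_mul ?_
  rintro ⟨b, b'⟩ ⟨hbη, hbX, hbΘ⟩ ⟨a, a'⟩ ⟨haη, haX, haΘ⟩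
  simp only at hbX hbΘ haX haΘ
  have hab : dist (b, b') (a, a') < 2 * η := by
    have := dist_triangle_right (b, b') (a, a') p
    rw [Metric.mem_ball] at hbη haη
    linarith
  have h1 : dist a b ≤ dist (b, b') (a, a') := by
    rw [dist_comm a b, Prod.dist_eq]; exact le_max_left _ _
  have h2 : dist a' b' ≤ dist (b, b') (a, a') := by
    rw [dist_comm a' b', Prod.dist_eq]; exact le_max_right _ _
  obtain ⟨γ, hγ0, hγ1, hγΘ, hγl⟩ := hc a' haΘ b' hbΘ (by
    have : η ≤ δ / 2 := min_le_left _ _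
    linarith)
  set D := dist (b, b') (a, a') with hD
  have hD0 : 0 ≤ D := dist_nonneg
  let G : ℝ → EuclideanSpace ℝ (Fin d) × EuclideanSpace ℝ (Fin q) :=
    fun t => (AffineMap.lineMap a b t, γ t)
  have hGl : ∀ u ∈ Icc (0 : ℝ) 1, ∀ t ∈ Icc (0 : ℝ) 1, dist (G u) (G t) ≤ c' * D * |u - t| := by
    intro u hu t ht
    rw [Prod.dist_eq]
    refine max_le ?_ ?_
    · simp only [G]
      rw [dist_lineMap_lineMap, Real.dist_eq, mul_comm]
      gcongr
      nlinarith
    · refine (hγl u hu t ht).trans ?_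
      gcongr
      exact le_max_left _ _
  have hGs : ∀ t ∈ Icc (0 : ℝ) 1, G t ∈ X ×ˢ Θ := fun t ht =>
    ⟨hX.lineMap_mem haX hbX ht, hγΘ t ht⟩
  have hG0 : G 0 = (a, a') := by simp [G, hγ0]
  have hG1 : G 1 = (b, b') := by simp [G, hγ1]
  have hGb : ∀ t ∈ Icc (0 : ℝ) 1, G t ∈ Metric.ball p ε ∩ X ×ˢ Θ := by
    intro t ht
    refine ⟨?_, hGs t ht⟩
    rw [Metric.mem_ball]
    have h3 := hGl t ht 0 (by simp)
    rw [hG0, sub_zero, abs_of_nonneg ht.1] at h3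
    rw [Metric.mem_ball] at haη
    have h4 : c' * D * t ≤ c' * D := mul_le_of_le_one_right (by positivity) ht.2
    have h5 : c' * D ≤ c' * (2 * η) := by gcongr
    have h6 : dist (G t) p ≤ dist (G t) (a, a') + dist (a, a') p := dist_triangle _ _ _
    nlinarith
  have h := norm_image_sub_le_of_curve (f := y) (f' := fun t => f' (G t)) (s := X ×ˢ Θ)
    (K := ‖f' p‖ + 1) (l := c' * D) (γ := G) (by positivity) hGl hGs
    (fun t ht => hf' _ (hball (hGb t ht)).1) (fun t ht => (hball (hGb t ht)).2.le)
  rw [hG0, hG1] at h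
  rw [dist_eq_norm]
  refine h.trans (le_of_eq ?_)
  rw [hD]
  change _ = (‖f' p‖ + 1) * c' * _
  ring

lemma abs_le_of_c1Norm_le {g : EuclideanSpace ℝ (Fin d) × EuclideanSpace ℝ (Fin q) →
      EuclideanSpace ℝ (Fin r)} {Γ : Set (EuclideanSpace ℝ (Fin d) × EuclideanSpace ℝ (Fin q))}
    {B : ℝ} (hB : 0 ≤ B) (hg : c1Norm Γ g ≤ ENNReal.ofReal B) {p} (hp : p ∈ Γ) (k : Fin r) :
    |g p k| ≤ B ∧ ∀ j : Fin q, |fderivWithin ℝ g Γ p (0, EuclideanSpace.single j 1) k| ≤ B := by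
  have h := (le_iSup_of_le p (le_iSup_of_le hp (le_iSup_of_le k le_rfl))).trans hg
  rw [max_le_iff, max_le_iff, iSup_le_iff, iSup_le_iff] at h
  refine ⟨?_, fun j => ?_⟩
  · have := h.1
    rwa [← ofReal_norm, ENNReal.ofReal_le_ofReal_iff hB] at this
  · have := h.2.2 j
    rwa [← ofReal_norm, ENNReal.ofReal_le_ofReal_iff hB] at this

/-- A bound on the `C¹` norm bounds the function and its Lipschitz constant in the second
variable. -/
lemma bounds_of_c1Norm_le (hΘ : LocallyQuasiconvex Θ) : ∃ A : ℝ, 0 ≤ A ∧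
    ∀ g : EuclideanSpace ℝ (Fin d) × EuclideanSpace ℝ (Fin q) → EuclideanSpace ℝ (Fin r),
    ContDiffOn ℝ 1 g (X ×ˢ Θ) → ∀ B : ℝ, 0 ≤ B → c1Norm (X ×ˢ Θ) g ≤ ENNReal.ofReal B →
    ∀ x ∈ X, ∀ s ∈ Θ, ∀ t ∈ Θ, ‖g (x, s)‖ ≤ A * B ∧ ‖g (x, s) - g (x, t)‖ ≤ A * B * ‖s - t‖ := by
  obtain ⟨c, δ, hδ, hc⟩ := hΘ
  set c' := max c 1 with hc'
  have hc1 : 1 ≤ c' := le_max_right _ _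
  -- The three summands serve the sup bound, pairs at distance at most δ (mean value along the
  -- curve), and pairs farther apart, where twice the sup bound suffices. None depends on g.
  refine ⟨r + q * r * c' + 2 * r / δ, by positivity, ?_⟩
  intro g hg B hB hgB x hx s hs t ht
  have hb : ∀ s ∈ Θ, ‖g (x, s)‖ ≤ r * B := fun s hs =>
    norm_le_mul_of_coord_le fun k => (abs_le_of_c1Norm_le hB hgB (p := (x, s)) ⟨hx, hs⟩ k).1
  refine ⟨(hb s hs).trans ?_, ?_⟩
  · have : (0 : ℝ) ≤ q * r * c' + 2 * r / δ := by positivity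
    gcongr
    linarith
  by_cases hd : dist t s ≤ δ
  · obtain ⟨γ, hγ0, hγ1, hγΘ, hγl⟩ := hc t ht s hs hd
    have hder : ∀ u ∈ Icc (0 : ℝ) 1, HasFDerivWithinAt (fun v => g (x, v))
        ((fderivWithin ℝ g (X ×ˢ Θ) (x, γ u)).comp
          (ContinuousLinearMap.inr ℝ (EuclideanSpace ℝ (Fin d)) (EuclideanSpace ℝ (Fin q))))
        Θ (γ u) := by
      intro u hu
      have h1 : HasFDerivWithinAt g (fderivWithin ℝ g (X ×ˢ Θ) (x, γ u)) (X ×ˢ Θ) (x, γ u) :=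
        ((hg _ ⟨hx, hγΘ u hu⟩).differentiableWithinAt (by simp)).hasFDerivWithinAt
      exact h1.comp (γ u) (hasFDerivAt_prodMk_right x (γ u)).hasFDerivWithinAt
        fun v hv => ⟨hx, hv⟩
    have h := norm_image_sub_le_of_curve (K := q * (r * B)) (l := c' * dist t s) (by positivity)
      (fun u hu v hv => (hγl u hu v hv).trans (by
        gcongr
        exact le_max_left _ _)) hγΘ hder
      (fun u hu => opNorm_le_of_coord_le hB fun j k => by
        simpa using (abs_le_of_c1Norm_le hB hgB (p := (x, γ u)) ⟨hx, hγΘ u hu⟩ k).2 j)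
    rw [hγ0, hγ1, dist_comm, dist_eq_norm] at h
    refine h.trans ?_
    have h2 : (0 : ℝ) ≤ (r + 2 * r / δ) * B * ‖s - t‖ := by positivity
    linarith
  · push Not at hd
    rw [dist_comm, dist_eq_norm] at hd
    have h1 : ‖g (x, s) - g (x, t)‖ ≤ r * B + r * B :=
      (norm_sub_le _ _).trans (add_le_add (hb s hs) (hb t ht))
    have h2 : r * B + r * B ≤ 2 * r / δ * B * ‖s - t‖ := by
      have h3 : (1 : ℝ) ≤ ‖s - t‖ / δ := by rw [le_div_iff₀ hδ]; linarith
      calc r * B + r * B = 2 * r * B * 1 := by ring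
        _ ≤ 2 * r * B * (‖s - t‖ / δ) := by gcongr
        _ = _ := by ring
    have h4 : (0 : ℝ) ≤ (r + q * r * c') * B * ‖s - t‖ := by positivity
    linarith

end Lipschitz


/-! ### The native semi-norm -/

section Native

variable {S : Type*} {Φ : S → S → ℝ} {P : Submodule ℝ (S → ℝ)}

lemma pairing_sub (c : S →₀ ℝ) (f g : S → ℝ) :
    pairing c (fun s => f s - g s) = pairing c f - pairing c g := by
  simp [pairing, Finsupp.sum, mul_sub, Finset.sum_sub_distrib]

lemma nativeNorm_nonneg (f : S → ℝ) : 0 ≤ nativeNorm Φ P f :=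
  Real.sInf_nonneg fun _ hC => hC.1

/-- The infimum defining the native semi-norm is attained. -/
lemma nativeBound_nativeNorm {f : S → ℝ} (hf : f ∈ nativeSpace Φ P) :
    NativeBound Φ P f (nativeNorm Φ P f) := by
  refine ⟨nativeNorm_nonneg f, fun c hc => ?_⟩
  -- When the root vanishes one cannot divide by it, but any single admissible constant already
  -- forces `pairing c f = 0`.
  rcases (Real.sqrt_nonneg (quadForm Φ c)).eq_or_lt with h | h
  · obtain ⟨C, hC⟩ := hf
    have := hC.2 c hc
    rw [← h] at this ⊢
    simpa using this
  · rw [← div_le_iff₀ h]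
    refine le_csInf hf fun C hC => ?_
    rw [div_le_iff₀ h]
    exact hC.2 c hc

lemma nativeNorm_sub_le {f g : S → ℝ} (hf : f ∈ nativeSpace Φ P) (hg : g ∈ nativeSpace Φ P) :
    (fun s => f s - g s) ∈ nativeSpace Φ P ∧
      nativeNorm Φ P (fun s => f s - g s) ≤ nativeNorm Φ P f + nativeNorm Φ P g := by
  have h : NativeBound Φ P (fun s => f s - g s) (nativeNorm Φ P f + nativeNorm Φ P g) := by
    refine ⟨add_nonneg (nativeNorm_nonneg f) (nativeNorm_nonneg g), fun c hc => ?_⟩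
    rw [pairing_sub, add_mul]
    exact (abs_sub _ _).trans
      (add_le_add ((nativeBound_nativeNorm hf).2 c hc) ((nativeBound_nativeNorm hg).2 c hc))
  exact ⟨⟨_, h⟩, csInf_le ⟨0, fun _ hC => hC.1⟩ h⟩

lemma nativeNorm_le_nativeNormVec {q : ℕ} (f : S → EuclideanSpace ℝ (Fin q)) (j : Fin q) :
    nativeNorm Φ P (fun s => f s j) ≤ nativeNormVec Φ P f :=
  Real.le_sqrt_of_sq_le (Finset.single_le_sum
    (f := fun j => nativeNorm Φ P (fun s => f s j) ^ 2) (fun _ _ => sq_nonneg _)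
    (Finset.mem_univ j))

lemma nativeNormVec_sq {q : ℕ} (f : S → EuclideanSpace ℝ (Fin q)) :
    nativeNormVec Φ P f ^ 2 = ∑ j, nativeNorm Φ P (fun s => f s j) ^ 2 :=
  Real.sq_sqrt (Finset.sum_nonneg fun _ _ => sq_nonneg _)

end Native

/-! ### Nets from the entropy condition -/

section Nets

variable {S : Type*} {Φ : S → S → ℝ} {P : Submodule ℝ (S → ℝ)}

lemma coveredBy_of_coveringNumber_eq {δ : ℝ} {A : Set (S → ℝ)} {N : ℕ}
    (h : coveringNumber δ A = N) : ∃ N' ≤ N, CoveredBy δ A N' := by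
  have h1 : coveringNumber δ A < ((N + 1 : ℕ) : ℕ∞) := by
    rw [h]; exact_mod_cast Nat.lt_succ_self N
  obtain ⟨N', h2⟩ := iInf_lt_iff.1 h1
  obtain ⟨h3, h4⟩ := iInf_lt_iff.1 h2
  exact ⟨N', by exact_mod_cast Nat.lt_succ_iff.1 (by exact_mod_cast h4), h3⟩

/-- Internal nets for classes of vector-valued functions with components in a set covered by
`N` balls. -/
lemma exists_net_of_coveredBy {q N : ℕ} {δ : ℝ} {A : Set (S → ℝ)}
    (hA : CoveredBy δ A N) (T : Set (S → EuclideanSpace ℝ (Fin q)))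
    (hT : ∀ f ∈ T, ∀ j, (fun s => f s j) ∈ A) :
    ∃ F : Finset (S → EuclideanSpace ℝ (Fin q)), (F : Set _) ⊆ T ∧ F.card ≤ N ^ q ∧
      ∀ f ∈ T, ∃ g ∈ F, ∀ s, ‖f s - g s‖ ≤ q * (2 * δ) := by
  classical
  obtain ⟨g, hg⟩ := hA
  let R : (Fin q → Fin N) → (S → EuclideanSpace ℝ (Fin q)) → Prop :=
    fun ι f => f ∈ T ∧ ∀ j s, |f s j - g (ι j) s| ≤ δ
  -- The centers of the balls may lie outside T. Each nonempty product cell is represented by one of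
  -- its own members, which doubles the radius but keeps the net inside T, where the values lie in Θ
  -- in the application.
  let rep : (Fin q → Fin N) → S → EuclideanSpace ℝ (Fin q) :=
    fun ι => if h : ∃ f, R ι f then h.choose else 0
  have hrep : ∀ ι, (∃ f, R ι f) → R ι (rep ι) := by
    intro ι h
    simp only [rep, dif_pos h]
    exact h.choose_spec
  refine ⟨(Finset.univ.filter fun ι => ∃ f, R ι f).image rep, ?_, ?_, ?_⟩
  · intro f hf
    simp only [Finset.coe_image, Set.mem_image, Finset.mem_coe, Finset.mem_filter] at hf
    obtain ⟨ι, ⟨-, h⟩, rfl⟩ := hf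
    exact (hrep ι h).1
  · refine Finset.card_image_le.trans ((Finset.card_filter_le _ _).trans ?_)
    simp
  · intro f hf
    choose ι hι using fun j => hg _ (hT f hf j)
    have h : ∃ f, R ι f := ⟨f, hf, hι⟩
    refine ⟨rep ι, Finset.mem_image_of_mem _ (by simpa using h), fun s => ?_⟩
    refine norm_le_mul_of_coord_le fun k => ?_
    have h1 := hι k s
    have h2 := (hrep ι h).2 k s
    rw [abs_le] at h1 h2 ⊢
    simp only [PiLp.sub_apply]
    constructor <;> linarith

/-- Internal nets for bounded subsets of the native space, by the entropy condition. -/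
lemma exists_net_of_entropy {d : ℕ} {ν : ℝ} (hent : EntropyCondition Φ P d ν) :
    ∃ C : ℝ, 0 < C ∧ ∀ (q : ℕ) (ε ρ : ℝ), 0 < ε → 0 < ρ →
      ∀ T : Set (S → EuclideanSpace ℝ (Fin q)),
      (∀ f ∈ T, ∀ j, (fun s => f s j) ∈ nativeBall Φ P ρ) →
      ∃ F : Finset (S → EuclideanSpace ℝ (Fin q)), (F : Set _) ⊆ T ∧
        (F.card : ℝ) ≤ Real.exp (q * (C * (q + 1) * ρ / ε) ^ ((d : ℝ) / ν)) ∧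
        ∀ f ∈ T, ∃ g ∈ F, ∀ s, ‖f s - g s‖ ≤ ε := by
  obtain ⟨C, hC, h⟩ := hent
  refine ⟨2 * C, by positivity, fun q ε ρ hε hρ T hT => ?_⟩
  -- The 2 pays for the internal centers and q for passing from coordinates to the norm; q + 1
  -- avoids dividing by zero when q = 0.
  have hε' : 0 < ε / (2 * (q + 1)) := by positivity
  obtain ⟨N, hN, hlog⟩ := h (ε / (2 * (q + 1))) ρ hε' hρ
  obtain ⟨N', hN', hcov⟩ := coveredBy_of_coveringNumber_eq hN
  obtain ⟨F, hFT, hFc, hF⟩ := exists_net_of_coveredBy hcov T hT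
  refine ⟨F, hFT, ?_, fun f hf => ?_⟩
  · have h1 : (N : ℝ) ≤ Real.exp ((2 * C * (q + 1) * ρ / ε) ^ ((d : ℝ) / ν)) := by
      have : C * ρ / (ε / (2 * (q + 1))) = 2 * C * (q + 1) * ρ / ε := by field_simp
      rw [this] at hlog
      exact (Real.le_exp_log _).trans (Real.exp_le_exp.2 hlog)
    calc (F.card : ℝ) ≤ (N' : ℝ) ^ q := by exact_mod_cast hFc
      _ ≤ (N : ℝ) ^ q := by gcongr
      _ ≤ (Real.exp ((2 * C * (q + 1) * ρ / ε) ^ ((d : ℝ) / ν))) ^ q := by gcongr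
      _ = _ := by rw [← Real.exp_nat_mul]
  · obtain ⟨g, hg, hfg⟩ := hF f hf
    refine ⟨g, hg, fun s => (hfg s).trans ?_⟩
    rw [show (q : ℝ) * (2 * (ε / (2 * (q + 1)))) = q / (q + 1) * ε by field_simp]
    refine mul_le_of_le_one_left hε.le ?_
    rw [div_le_one (by positivity)]
    linarith

end Nets

/-! ### Sub-Gaussian tails of linear functionals of the noise -/

section Tail

variable {Ω : Type*} [MeasurableSpace Ω] {μ : Measure Ω}

/-- Centered vectors that are sub-Gaussian in the present sense are so in each direction in
the sense of moment generating functions. -/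
lemma IsSubGaussian.hasSubgaussianMGF_inner {r : ℕ} {ξ : Ω → EuclideanSpace ℝ (Fin r)} {σ : ℝ}
    (h : IsSubGaussian ξ σ μ) (h0 : ∫ ω, ξ ω ∂μ = 0) (v : EuclideanSpace ℝ (Fin r)) :
    HasSubgaussianMGF (fun ω => inner ℝ v (ξ ω)) (Real.toNNReal (σ ^ 2 * ‖v‖ ^ 2)) μ := by
  have hcoe : ((Real.toNNReal (σ ^ 2 * ‖v‖ ^ 2) : NNReal) : ℝ) = σ ^ 2 * ‖v‖ ^ 2 :=
    Real.coe_toNNReal _ (by positivity)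
  refine ⟨fun t => ?_, fun t => ?_⟩
  · have := h.integrable_exp (t • v)
    simpa [h0, inner_smul_left] using this
  · have := h.bound (t • v)
    rw [hcoe]
    simp only [mgf]
    simp only [h0, sub_zero, inner_smul_left, norm_smul, RCLike.conj_to_real] at this
    refine this.trans (Real.exp_le_exp.2 (le_of_eq ?_))
    rw [mul_pow, Real.norm_eq_abs, sq_abs]
    ring

/-- Two-sided Chernoff bound for linear functionals of a noise vector with independent
sub-Gaussian blocks. -/
lemma measure_abs_inner_gt_le [IsProbabilityMeasure μ] {n r : ℕ} {e : Fin n → Ω → EuclideanSpace ℝ (Fin r)} {σ : ℝ}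
    (hσ : 0 < σ) (hi : iIndepFun e μ)
    (h0 : ∀ i, ∫ ω, e i ω ∂μ = 0) (hsub : ∀ i, IsSubGaussian (e i) σ μ)
    (w : PiLp 2 fun _ : Fin n => EuclideanSpace ℝ (Fin r)) {s u : ℝ} (hs : 0 < s) (hu : 0 ≤ u)
    (hw : ‖w‖ ≤ s) :
    μ {ω | u < |inner ℝ w (WithLp.toLp 2 fun i => e i ω)|} ≤
      ENNReal.ofReal (2 * Real.exp (-u ^ 2 / (2 * σ ^ 2 * s ^ 2))) := by
  have key : ∀ w : PiLp 2 fun _ : Fin n => EuclideanSpace ℝ (Fin r), ‖w‖ ≤ s →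
      μ.real {ω | u ≤ inner ℝ w (WithLp.toLp 2 fun i => e i ω)} ≤
        Real.exp (-u ^ 2 / (2 * σ ^ 2 * s ^ 2)) := by
    intro w hw
    have hX : iIndepFun (fun i ω => (inner ℝ (w i) (e i ω) : ℝ)) μ :=
      hi.comp (fun i v => (inner ℝ (w i) v : ℝ)) fun i => by fun_prop
    have hS := HasSubgaussianMGF.sum_of_iIndepFun hX (s := Finset.univ)
      fun i _ => (hsub i).hasSubgaussianMGF_inner (h0 i) (w i)
    have hc : ((∑ i, Real.toNNReal (σ ^ 2 * ‖w i‖ ^ 2) : NNReal) : ℝ) = σ ^ 2 * ‖w‖ ^ 2 := by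
      rw [PiLp.norm_sq_eq_of_L2, NNReal.coe_sum, Finset.mul_sum]
      exact Finset.sum_congr rfl fun i _ => Real.coe_toNNReal _ (by positivity)
    -- Enlarging the variance proxy from σ²‖w‖² to σ²s² keeps it positive even when w = 0.
    have hS' : HasSubgaussianMGF (fun ω => ∑ i, (inner ℝ (w i) (e i ω) : ℝ))
        (Real.toNNReal (σ ^ 2 * s ^ 2)) μ := by
      refine ⟨hS.integrable_exp_mul, fun t => (hS.mgf_le t).trans (Real.exp_le_exp.2 ?_)⟩
      rw [hc, Real.coe_toNNReal _ (by positivity)]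
      gcongr
    have h := hS'.measure_ge_le hu
    rw [Real.coe_toNNReal _ (by positivity)] at h
    simp only [PiLp.inner_apply]
    rw [show 2 * σ ^ 2 * s ^ 2 = 2 * (σ ^ 2 * s ^ 2) by ring]
    exact h
  have hsubset : {ω | u < |inner ℝ w (WithLp.toLp 2 fun i => e i ω)|} ⊆
      {ω | u ≤ inner ℝ w (WithLp.toLp 2 fun i => e i ω)} ∪
        {ω | u ≤ inner ℝ (-w) (WithLp.toLp 2 fun i => e i ω)} := by
    intro ω hω
    simp only [Set.mem_ofPred_eq, lt_abs, inner_neg_left, Set.mem_union] at hω ⊢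
    exact hω.imp le_of_lt le_of_lt
  refine (measure_mono hsubset).trans ((measure_union_le _ _).trans ?_)
  rw [two_mul, ENNReal.ofReal_add (by positivity) (by positivity)]
  refine add_le_add ?_ ?_
  · exact (ENNReal.le_ofReal_iff_toReal_le (by finiteness) (by positivity)).2 (key w hw)
  · exact (ENNReal.le_ofReal_iff_toReal_le (by finiteness) (by positivity)).2
      (key (-w) (by rwa [norm_neg]))

end Tail


/-! ### Chaining and peeling -/

section Chaining

variable {Ω : Type*} [MeasurableSpace Ω] {μ : Measure Ω}
  {V : Type*} [NormedAddCommGroup V] [InnerProductSpace ℝ V]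

lemma exp_neg_le_inv {u : ℝ} (hu : 0 < u) : Real.exp (-u) ≤ 1 / u := by
  rw [Real.exp_neg, ← one_div]
  exact one_div_le_one_div_of_le hu ((by linarith : u ≤ u + 1).trans (Real.add_one_le_exp u))

/-- Chaining along nets at a fixed point of the sample space. -/
lemma abs_inner_sub_le_of_chain {v w₀ w : V} {π : ℕ → V} {t : ℝ} {g : ℝ} (hg0 : 0 ≤ g)
    (hg1 : g < 1) (ht : 0 ≤ t) (h0 : π 0 = w₀) (hlim : Tendsto π atTop (nhds w))
    (hstep : ∀ k, |inner ℝ (π (k + 1) - π k) v| ≤ t * g ^ k) :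
    |inner ℝ (w - w₀) v| ≤ t / (1 - g) := by
  have hk : ∀ k, |inner ℝ (π k - w₀) v| ≤ ∑ i ∈ Finset.range k, t * g ^ i := by
    intro k
    induction k with
    | zero => simp [h0]
    | succ k ih =>
      rw [Finset.sum_range_succ, show π (k + 1) - w₀ = (π k - w₀) + (π (k + 1) - π k) by abel,
        inner_add_left]
      exact (abs_add_le _ _).trans (add_le_add ih (hstep k))
  have hsum : ∀ k, ∑ i ∈ Finset.range k, t * g ^ i ≤ t / (1 - g) := by
    intro k
    have h := (summable_geometric_of_lt_one hg0 hg1).sum_le_tsum (Finset.range k)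
      fun i _ => by positivity
    rw [tsum_geometric_of_lt_one hg0 hg1] at h
    rw [← Finset.mul_sum, div_eq_mul_inv]
    exact mul_le_mul_of_nonneg_left h ht
  have hl : Tendsto (fun k => |inner ℝ (π k - w₀) v|) atTop (nhds |inner ℝ (w - w₀) v|) :=
    ((hlim.sub_const w₀).inner tendsto_const_nhds).abs
  exact le_of_tendsto hl (Eventually.of_forall fun k => (hk k).trans (hsum k))

/-- Chaining with peeling for a linear process with sub-Gaussian tails: simultaneous bounds on
all shells `A j`. -/
lemma exists_event_chaining {e : Ω → V} {σ : ℝ} (hσ : 0 < σ)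
    (htail : ∀ (w : V) (s u : ℝ), 0 < s → 0 ≤ u → ‖w‖ ≤ s →
      μ {ω | u < |inner ℝ w (e ω)|} ≤
        ENNReal.ofReal (2 * Real.exp (-u ^ 2 / (2 * σ ^ 2 * s ^ 2))))
    {h B D H M₀ Q : ℝ} (hh2 : 2 ≤ h) (hh4 : h < 4) (hB : 0 < B) (hD : 0 < D) (hH : 1 ≤ H)
    (hM₀ : 1 ≤ M₀) (hQ : 10 * B ≤ Q) (A : ℕ → Set V) (w₀ : V) (F : ℕ → ℕ → Finset V)
    (hF0 : ∀ j, F j 0 = {w₀}) (hFc : ∀ j k, ((F j k).card : ℝ) ≤ Real.exp (B * h ^ k * H))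
    (hF : ∀ j k, ∀ w ∈ A j, ∃ w' ∈ F j k, ‖w - w'‖ ≤ D * (M₀ * 2 ^ j) * √H / 2 ^ k) :
    ∃ bad : Set Ω, μ bad ≤ ENNReal.ofReal (16 / Q) ∧ ∀ ω ∉ bad, ∀ j, ∀ w ∈ A j,
      |inner ℝ (w - w₀) (e ω)| ≤
        σ * D * √(8 * Q) * ((M₀ * 2 ^ j) * √(M₀ * 2 ^ j) * H) / (1 - √h / 2) := by
  have hQ0 : 0 < Q := by linarith
  have hH0 : 0 < H := by linarith
  set M : ℕ → ℝ := fun j => M₀ * 2 ^ j with hM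
  have hMpos : ∀ j, 0 < M j := fun j => by positivity
  set g := √h / 2 with hg
  have hg0 : 0 ≤ g := by positivity
  have hg1 : g < 1 := by
    rw [hg, div_lt_one (by norm_num), Real.sqrt_lt' (by norm_num)]
    norm_num [hh4]
  -- Chosen so that t²/(2σ²s²) = Q M_j h^k H for links of length at most s: this exceeds the entropy
  -- of two consecutive nets and grows with the shell. The ratio g = √h/2 < 1 makes the thresholds
  -- summable in k.
  set t : ℕ → ℕ → ℝ := fun j k => σ * D * √(8 * Q) * (M j * √(M j) * H) * g ^ k with ht
  set s : ℕ → ℕ → ℝ := fun j k => 2 * (D * M j * √H / 2 ^ k) with hs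
  let E : ℕ → ℕ → V → V → Set Ω := fun j k w w' =>
    {ω | ‖w' - w‖ ≤ s j k ∧ t j k < |inner ℝ (w' - w) (e ω)|}
  let bad : Set Ω := ⋃ j, ⋃ k, ⋃ w ∈ F j k, ⋃ w' ∈ F j (k + 1), E j k w w'
  have hE : ∀ j k w w', μ (E j k w w') ≤ ENNReal.ofReal (2 * Real.exp (-(Q * M j * h ^ k * H))) := by
    intro j k w w'
    by_cases hw : ‖w' - w‖ ≤ s j k
    · have hs0 : 0 < s j k := by
        have := hMpos j
        simp only [hs]; positivity
      have ht0 : 0 ≤ t j k := by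
        have := hMpos j
        simp only [ht]; positivity
      refine (measure_mono ?_).trans ((htail (w' - w) (s j k) (t j k) hs0 ht0 hw).trans ?_)
      · exact fun ω hω => hω.2
      · refine ENNReal.ofReal_le_ofReal ?_
        have hsq : (t j k) ^ 2 = 2 * σ ^ 2 * (s j k) ^ 2 * (Q * M j * h ^ k * H) := by
          simp only [ht, hs, hg]
          have e1 : √(8 * Q) ^ 2 = 8 * Q := Real.sq_sqrt (by positivity)
          have e2 : √(M j) ^ 2 = M j := Real.sq_sqrt (hMpos j).le
          have e3 : √H ^ 2 = H := Real.sq_sqrt hH0.le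
          have e4 : √h ^ 2 = h := Real.sq_sqrt (by linarith)
          have e5 : (√h / 2) ^ k = √h ^ k / 2 ^ k := div_pow _ _ _
          have e6 : (√h ^ k) ^ 2 = h ^ k := by rw [← pow_mul, mul_comm, pow_mul, e4]
          rw [e5]
          calc (σ * D * √(8 * Q) * (M j * √(M j) * H) * (√h ^ k / 2 ^ k)) ^ 2
              = σ ^ 2 * D ^ 2 * √(8 * Q) ^ 2 * (M j ^ 2 * √(M j) ^ 2 * H ^ 2) *
                  ((√h ^ k) ^ 2 / (2 ^ k) ^ 2) := by ring
            _ = 2 * σ ^ 2 * (2 ^ 2 * (D ^ 2 * M j ^ 2 * √H ^ 2 / (2 ^ k) ^ 2)) *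
                  (Q * M j * h ^ k * H) := by rw [e1, e2, e3, e6]; ring
            _ = _ := by ring
        rw [neg_div, hsq, mul_div_cancel_left₀ _ (by positivity)]
    · have : E j k w w' = ∅ := by
        ext ω
        simp [E, hw]
      simp [this]
  have hjk : ∀ j k, μ (⋃ w ∈ F j k, ⋃ w' ∈ F j (k + 1), E j k w w') ≤
      ENNReal.ofReal (4 / Q) * (2⁻¹ ^ j * 2⁻¹ ^ k) := by
    intro j k
    have h1 : μ (⋃ w ∈ F j k, ⋃ w' ∈ F j (k + 1), E j k w w') ≤
        ∑ _w ∈ F j k, ∑ _w' ∈ F j (k + 1),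
          ENNReal.ofReal (2 * Real.exp (-(Q * M j * h ^ k * H))) :=
      (measure_biUnion_finset_le _ _).trans (Finset.sum_le_sum fun w _ =>
        (measure_biUnion_finset_le _ _).trans (Finset.sum_le_sum fun w' _ => hE j k w w'))
    refine h1.trans ?_
    simp only [Finset.sum_const, nsmul_eq_mul]
    rw [← ENNReal.ofReal_natCast, ← ENNReal.ofReal_natCast, ← ENNReal.ofReal_mul (by positivity),
      ← ENNReal.ofReal_mul (by positivity)]
    have h2 : (2⁻¹ ^ j * 2⁻¹ ^ k : ℝ≥0∞) = ENNReal.ofReal (2⁻¹ ^ j * 2⁻¹ ^ k) := by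
      rw [ENNReal.ofReal_mul (by positivity), ENNReal.ofReal_pow (by positivity),
        ENNReal.ofReal_pow (by positivity), ENNReal.ofReal_inv_of_pos (by norm_num)]
      simp
    rw [h2, ← ENNReal.ofReal_mul (by positivity)]
    refine ENNReal.ofReal_le_ofReal ?_
    have hk0 : 0 < h ^ k * H := by positivity
    have hM1 : (2 : ℝ) ^ j ≤ M j := le_mul_of_one_le_left (by positivity) hM₀
    have hM1' : (1 : ℝ) ≤ M j := (one_le_pow₀ (by norm_num)).trans hM1
    have h3 : (2 : ℝ) ^ k ≤ h ^ k * H :=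
      (pow_le_pow_left₀ (by norm_num) hh2 k).trans (le_mul_of_one_le_right (by positivity) hH)
    calc ((F j k).card : ℝ) * (((F j (k + 1)).card : ℝ) *
          (2 * Real.exp (-(Q * M j * h ^ k * H))))
        ≤ Real.exp (B * h ^ k * H) * (Real.exp (B * h ^ (k + 1) * H) *
          (2 * Real.exp (-(Q * M j * h ^ k * H)))) := by
          gcongr
          · exact hFc j k
          · exact hFc j (k + 1)
      _ = 2 * Real.exp (B * h ^ k * H + B * h ^ (k + 1) * H + -(Q * M j * h ^ k * H)) := by
          rw [Real.exp_add, Real.exp_add]; ring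
      _ ≤ 2 * Real.exp (-(Q / 2 * (2 ^ j * 2 ^ k))) := by
          gcongr
          -- Since 1 + h ≤ 5 and Q ≥ 10 B, the number of pairs of net points uses up at most half of
          -- the exponent.
          have h4 : B * h ^ k * H + B * h ^ (k + 1) * H ≤ 5 * B * (h ^ k * H) := by
            rw [pow_succ]
            nlinarith [mul_pos hB hk0]
          have h5 : 5 * B * (h ^ k * H) ≤ Q / 2 * M j * (h ^ k * H) := by
            refine mul_le_mul_of_nonneg_right ?_ hk0.le
            nlinarith
          have h6 : Q / 2 * (2 ^ j * 2 ^ k) ≤ Q / 2 * (M j * (h ^ k * H)) := by gcongr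
          nlinarith
      -- The crude bound e^{-u} ≤ 1/u already gives a double geometric series, of total 16/Q.
      _ ≤ 2 * (1 / (Q / 2 * (2 ^ j * 2 ^ k))) := by
          gcongr
          exact exp_neg_le_inv (by positivity)
      _ = 4 / Q * (2⁻¹ ^ j * 2⁻¹ ^ k) := by
          rw [inv_pow, inv_pow]
          field_simp
          norm_num
  refine ⟨bad, ?_, ?_⟩
  · calc μ bad ≤ ∑' j, ∑' k, μ (⋃ w ∈ F j k, ⋃ w' ∈ F j (k + 1), E j k w w') :=
          (measure_iUnion_le _).trans (ENNReal.tsum_le_tsum fun j => measure_iUnion_le _)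
      _ ≤ ∑' (j : ℕ), ∑' (k : ℕ), ENNReal.ofReal (4 / Q) * (2⁻¹ ^ j * 2⁻¹ ^ k) :=
          ENNReal.tsum_le_tsum fun j => ENNReal.tsum_le_tsum fun k => hjk j k
      _ = ENNReal.ofReal (4 / Q) * (2 * 2) := by
          simp only [ENNReal.tsum_mul_left, ENNReal.tsum_mul_right, ENNReal.tsum_geometric,
            ENNReal.one_sub_inv_two, inv_inv]
      _ = ENNReal.ofReal (16 / Q) := by
          rw [show (2 * 2 : ℝ≥0∞) = ENNReal.ofReal 4 by norm_num,
            ← ENNReal.ofReal_mul (by positivity)]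
          congr 1
          ring
  · intro ω hω j w hw
    choose π hπF hπ using fun k => hF j k w hw
    have hMj := hMpos j
    refine abs_inner_sub_le_of_chain (π := π) hg0 hg1 (by positivity) ?_ ?_ ?_
    · simpa [hF0] using hπF 0
    · rw [tendsto_iff_norm_sub_tendsto_zero]
      have hle : ∀ k, ‖π k - w‖ ≤ D * (M₀ * 2 ^ j) * √H / 2 ^ k := fun k => by
        rw [norm_sub_rev]; exact hπ k
      refine squeeze_zero (fun _ => norm_nonneg _) hle ?_
      have := (tendsto_pow_atTop_nhds_zero_of_lt_one (r := (2 : ℝ)⁻¹) (by norm_num)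
        (by norm_num)).const_mul (D * (M₀ * 2 ^ j) * √H)
      simpa [div_eq_mul_inv] using this
    · intro k
      by_contra hcon
      push Not at hcon
      refine hω (Set.mem_iUnion.2 ⟨j, Set.mem_iUnion.2 ⟨k, Set.mem_iUnion₂.2
        ⟨π k, hπF k, Set.mem_iUnion₂.2 ⟨π (k + 1), hπF (k + 1), ?_, hcon⟩⟩⟩⟩)
      have h1 := hπ k
      have h2 := hπ (k + 1)
      have h3 : D * (M₀ * 2 ^ j) * √H / 2 ^ (k + 1) ≤ D * (M₀ * 2 ^ j) * √H / 2 ^ k := by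
        gcongr
        · norm_num
        · omega
      calc ‖π (k + 1) - π k‖ = ‖(w - π k) - (w - π (k + 1))‖ := by congr 1; abel
        _ ≤ ‖w - π k‖ + ‖w - π (k + 1)‖ := norm_sub_le _ _
        _ ≤ s j k := by
          simp only [hs, hM]
          linarith

end Chaining


/-! ### Uniform control of the noise process over the native space -/

section EmpiricalProcess

variable {Ω : Type*} [MeasurableSpace Ω] {μ : Measure Ω} [IsProbabilityMeasure μ]
  {d q r : ℕ} {X : Set (EuclideanSpace ℝ (Fin d))} {Θ : Set (EuclideanSpace ℝ (Fin q))}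
  {Φ : X → X → ℝ} {P : Submodule ℝ (X → ℝ)}

/-- The rate exponent balances entropy and sample size: `n a² = a^{-d/ν}` for
`a = n^{-ν/(2ν+d)}`. -/
lemma rate_balance {ν : ℝ} (hν : 0 < ν) {n : ℕ} (hn : 1 ≤ n) :
    (n : ℝ) * ((n : ℝ) ^ (-(ν / (2 * ν + d)))) ^ 2 =
      ((n : ℝ) ^ (-(ν / (2 * ν + d))))⁻¹ ^ ((d : ℝ) / ν) := by
  have hn0 : (0 : ℝ) < n := by exact_mod_cast hn
  have hd : (0 : ℝ) < 2 * ν + d := by positivity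
  rw [← Real.rpow_neg hn0.le, ← Real.rpow_mul hn0.le, ← Real.rpow_natCast, ← Real.rpow_mul hn0.le]
  nth_rewrite 1 [← Real.rpow_one (n : ℝ)]
  rw [← Real.rpow_add hn0]
  congr 1
  push_cast
  field_simp
  ring

lemma norm_toLp_le {n : ℕ} {v : Fin n → EuclideanSpace ℝ (Fin r)} {c : Fin n → ℝ} {L : ℝ}
    (hL : 0 ≤ L) (h : ∀ i, ‖v i‖ ≤ L * c i) :
    ‖(WithLp.toLp 2 v : PiLp 2 fun _ : Fin n => EuclideanSpace ℝ (Fin r))‖ ≤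
      L * √(∑ i, c i ^ 2) := by
  rw [PiLp.norm_eq_of_L2]
  refine Real.sqrt_le_iff.2 ⟨by positivity, ?_⟩
  rw [mul_pow, Real.sq_sqrt (Finset.sum_nonneg fun _ _ => sq_nonneg _), Finset.mul_sum]
  refine Finset.sum_le_sum fun i _ => ?_
  rw [← mul_pow]
  exact pow_le_pow_left₀ (norm_nonneg _) (h i) 2

/-- Uniform modulus of continuity at `θstar` of the empirical process indexed by the native
space, on an event of large probability, uniformly in the sample size. -/
lemma exists_event_process {ν : ℝ} (hν : (d : ℝ) / 2 < ν) (hent : EntropyCondition Φ P d ν)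
    {σ : ℝ} (hσ : 0 < σ) {L : ℝ} (hL : 0 < L) {θstar : X → EuclideanSpace ℝ (Fin q)}
    (hθstar : θstar ∈ nativeSpaceIn Φ P Θ) {M₀ : ℝ} (hM₀ : 1 ≤ M₀) {ε : ℝ} (hε : 0 < ε) :
    ∃ K : ℝ, 0 ≤ K ∧ ∀ n : ℕ, 1 ≤ n → ∀ (x : Fin n → X) (e : Fin n → Ω → EuclideanSpace ℝ (Fin r)),
      iIndepFun e μ → (∀ i, ∫ ω, e i ω ∂μ = 0) → (∀ i, IsSubGaussian (e i) σ μ) →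
      ∀ f : EuclideanSpace ℝ (Fin d) × EuclideanSpace ℝ (Fin q) → EuclideanSpace ℝ (Fin r),
      (∀ z ∈ X, ∀ s ∈ Θ, ∀ t ∈ Θ, ‖f (z, s) - f (z, t)‖ ≤ L * ‖s - t‖) →
      ∃ bad : Set Ω, μ bad ≤ ENNReal.ofReal ε ∧ ∀ ω ∉ bad, ∀ θ ∈ nativeSpaceIn Φ P Θ, ∀ m : ℝ,
        M₀ ≤ m → nativeNormVec Φ P θ ≤ m →
        √(∑ i, ‖θ (x i) - θstar (x i)‖ ^ 2) ≤
          m * √(n * ((n : ℝ) ^ (-(ν / (2 * ν + d)))) ^ 2) →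
        |∑ i, inner ℝ (f (x i, θ (x i)) - f (x i, θstar (x i))) (e i ω)| ≤
          K * (m * √m) * (n * ((n : ℝ) ^ (-(ν / (2 * ν + d)))) ^ 2) := by
  obtain ⟨C, hC, hnet⟩ := exists_net_of_entropy hent
  have hν0 : 0 < ν := lt_of_le_of_lt (by positivity) hν
  have hτ : (d : ℝ) / ν < 2 := by rw [div_lt_iff₀ hν0]; linarith
  have hτ0 : (0 : ℝ) ≤ (d : ℝ) / ν := by positivity
  -- With τ = d/ν < 2, the exponent 1 + τ/2 is at least max(1, τ) and below 2. Hence h^k dominates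
  -- the entropy growth 2^{kτ}, while 2 ≤ h < 4 as chaining requires.
  set h : ℝ := 2 ^ (1 + (d : ℝ) / ν / 2) with hh
  have hh2 : 2 ≤ h := by
    calc (2 : ℝ) = 2 ^ (1 : ℝ) := by simp
      _ ≤ h := Real.rpow_le_rpow_of_exponent_le (by norm_num) (by linarith)
  have hh4 : h < 4 := by
    calc h < 2 ^ (2 : ℝ) := Real.rpow_lt_rpow_of_exponent_lt (by norm_num) (by linarith)
      _ = 4 := by norm_num
  set B : ℝ := q * (C * (q + 1)) ^ ((d : ℝ) / ν) + 1 with hB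
  have hB0 : 0 < B := by positivity
  set Q : ℝ := max (10 * B) (16 / ε) with hQ
  have hQB : 10 * B ≤ Q := le_max_left _ _
  have hQ0 : 0 < Q := by linarith
  have hQε : 16 / Q ≤ ε := by
    rw [div_le_iff₀ hQ0, mul_comm, ← div_le_iff₀ hε]
    exact le_max_right _ _
  have hg1 : 0 < 1 - √h / 2 := by
    have : √h < 2 := by
      rw [Real.sqrt_lt' (by norm_num)]; norm_num [hh4]
    linarith
  refine ⟨4 * (σ * L * √(8 * Q) / (1 - √h / 2)), by positivity, ?_⟩
  intro n hn x e hind h0 hsub f hf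
  have hn0 : (0 : ℝ) < n := by exact_mod_cast hn
  set a : ℝ := (n : ℝ) ^ (-(ν / (2 * ν + d))) with ha
  have ha0 : 0 < a := by positivity
  have ha1 : a ≤ 1 := Real.rpow_le_one_of_one_le_of_nonpos (by exact_mod_cast hn)
    (by rw [neg_nonpos]; positivity)
  set H : ℝ := n * a ^ 2 with hH
  have hHa : H = a⁻¹ ^ ((d : ℝ) / ν) := rate_balance hν0 hn
  have hH1 : 1 ≤ H := by
    rw [hHa]
    exact Real.one_le_rpow ((one_le_inv₀ ha0).2 ha1) hτ0
  have hsH : √H = √n * a := by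
    rw [hH, Real.sqrt_mul hn0.le, Real.sqrt_sq ha0.le]
  let w : (X → EuclideanSpace ℝ (Fin q)) → PiLp 2 fun _ : Fin n => EuclideanSpace ℝ (Fin r) :=
    fun θ => WithLp.toLp 2 fun i => f (x i, θ (x i))
  have hw : ∀ θ ∈ nativeSpaceIn Φ P Θ, ∀ θ' ∈ nativeSpaceIn Φ P Θ,
      ‖w θ - w θ'‖ ≤ L * √(∑ i, ‖θ (x i) - θ' (x i)‖ ^ 2) := by
    intro θ hθ θ' hθ'
    refine norm_toLp_le (v := fun i => f (x i, θ (x i)) - f (x i, θ' (x i))) hL.le fun i => ?_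
    exact hf _ (x i).2 _ (hθ.2 _) _ (hθ'.2 _)
  let T : ℕ → Set (X → EuclideanSpace ℝ (Fin q)) := fun j =>
    {θ | θ ∈ nativeSpaceIn Φ P Θ ∧ nativeNormVec Φ P θ ≤ M₀ * 2 ^ j ∧
      √(∑ i, ‖θ (x i) - θstar (x i)‖ ^ 2) ≤ M₀ * 2 ^ j * √H}
  have hFex : ∀ j k, ∃ F : Finset (PiLp 2 fun _ : Fin n => EuclideanSpace ℝ (Fin r)),
      (k = 0 → F = {w θstar}) ∧ (F.card : ℝ) ≤ Real.exp (B * h ^ k * H) ∧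
      ∀ v ∈ w '' T j, ∃ v' ∈ F, ‖v - v'‖ ≤ L * (M₀ * 2 ^ j) * √H / 2 ^ k := by
    classical
    intro j k
    -- At level 0 the constraint on the design points puts the whole shell in one ball around θ*. At
    -- higher levels a sup-norm net of resolution M_j a/2^k is used: the ratio of radius to
    -- resolution is 2^k/a for every j, and the ℓ₂ distances at the design points are at most √n M_j
    -- a/2^k = M_j √H/2^k.
    rcases Nat.eq_zero_or_pos k with rfl | hk
    · refine ⟨{w θstar}, fun _ => rfl, ?_, ?_⟩
      · simp only [Finset.card_singleton, Nat.cast_one]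
        exact Real.one_le_exp (by positivity)
      · rintro _ ⟨θ, hθ, rfl⟩
        refine ⟨_, Finset.mem_singleton_self _, (hw θ hθ.1 θstar hθstar).trans ?_⟩
        rw [pow_zero, div_one, mul_assoc]
        gcongr
        exact hθ.2.2
    · obtain ⟨F, hFT, hFc, hF⟩ := hnet q (M₀ * 2 ^ j * a / 2 ^ k) (M₀ * 2 ^ j) (by positivity)
        (by positivity) (T j) fun θ hθ l =>
          ⟨hθ.1.1 l, (nativeNorm_le_nativeNormVec θ l).trans hθ.2.1⟩
      refine ⟨F.image w, fun h => by omega, ?_, ?_⟩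
      · refine (Nat.cast_le.2 Finset.card_image_le).trans (hFc.trans (Real.exp_le_exp.2 ?_))
        have e1 : C * (q + 1) * (M₀ * 2 ^ j) / (M₀ * 2 ^ j * a / 2 ^ k) =
            C * (q + 1) * 2 ^ k * a⁻¹ := by field_simp
        rw [e1, Real.mul_rpow (by positivity) (by positivity),
          Real.mul_rpow (by positivity) (by positivity), ← hHa]
        have e2 : ((2 : ℝ) ^ k) ^ ((d : ℝ) / ν) ≤ h ^ k := by
          rw [← Real.rpow_natCast, ← Real.rpow_mul (by norm_num), mul_comm,
            Real.rpow_mul (by norm_num), Real.rpow_natCast]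
          exact pow_le_pow_left₀ (by positivity)
            (Real.rpow_le_rpow_of_exponent_le (by norm_num) (by linarith)) k
        calc (q : ℝ) * ((C * (q + 1)) ^ ((d : ℝ) / ν) * (2 ^ k) ^ ((d : ℝ) / ν) * H)
            ≤ q * ((C * (q + 1)) ^ ((d : ℝ) / ν) * h ^ k * H) := by gcongr
          _ = (q * (C * (q + 1)) ^ ((d : ℝ) / ν)) * h ^ k * H := by ring
          _ ≤ B * h ^ k * H := by
              gcongr
              rw [hB]; linarith
      · rintro _ ⟨θ, hθ, rfl⟩
        obtain ⟨θ', hθ', hd⟩ := hF θ hθ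
        refine ⟨w θ', Finset.mem_image_of_mem _ hθ', (hw θ hθ.1 θ' (hFT hθ').1).trans ?_⟩
        have e3 : √(∑ i, ‖θ (x i) - θ' (x i)‖ ^ 2) ≤ √n * (M₀ * 2 ^ j * a / 2 ^ k) := by
          refine Real.sqrt_le_iff.2 ⟨by positivity, ?_⟩
          rw [mul_pow, Real.sq_sqrt hn0.le]
          calc ∑ i, ‖θ (x i) - θ' (x i)‖ ^ 2
              ≤ ∑ _i : Fin n, (M₀ * 2 ^ j * a / 2 ^ k) ^ 2 :=
                Finset.sum_le_sum fun i _ => pow_le_pow_left₀ (norm_nonneg _) (hd _) 2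
            _ = _ := by simp
        refine (mul_le_mul_of_nonneg_left e3 hL.le).trans (le_of_eq ?_)
        rw [hsH]; ring
  choose F hF0 hFc hF using hFex
  obtain ⟨bad, hbad, hgood⟩ := exists_event_chaining (μ := μ)
    (e := fun ω => (WithLp.toLp 2 fun i => e i ω : PiLp 2 fun _ : Fin n =>
      EuclideanSpace ℝ (Fin r))) hσ
    (fun v s u hs hu hv => measure_abs_inner_gt_le hσ hind h0 hsub v hs hu hv)
    hh2 hh4 hB0 hL hH1 hM₀ hQB (fun j => w '' T j) (w θstar) F (fun j => hF0 j 0 rfl) hFc hF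
  refine ⟨bad, hbad.trans (ENNReal.ofReal_le_ofReal hQε), ?_⟩
  intro ω hω θ hθ m hm hR hs
  -- Rounding m up to a dyadic shell at most doubles it, so m √m grows by at most the factor 4 in
  -- the constant.
  obtain ⟨j, hjm, hj⟩ : ∃ j : ℕ, m ≤ M₀ * 2 ^ j ∧ M₀ * 2 ^ j ≤ 2 * m := by
    obtain ⟨j, hj1, hj2⟩ := exists_nat_pow_near (x := m / M₀) (y := (2 : ℝ))
      (by rw [le_div_iff₀ (by linarith)]; linarith) (by norm_num)
    have hMp : 0 < M₀ := by linarith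
    rw [le_div_iff₀ hMp] at hj1
    rw [div_lt_iff₀ hMp] at hj2
    exact ⟨j + 1, by linarith, by rw [pow_succ]; linarith⟩
  have hm0 : 0 < m := by linarith
  have hmem : w θ ∈ w '' T j := Set.mem_image_of_mem _
    ⟨hθ, hR.trans hjm, hs.trans (mul_le_mul_of_nonneg_right hjm (Real.sqrt_nonneg _))⟩
  have hb := hgood ω hω j (w θ) hmem
  have hinner : (inner ℝ (w θ - w θstar) (WithLp.toLp 2 fun i => e i ω : PiLp 2 fun _ : Fin n =>
      EuclideanSpace ℝ (Fin r)) : ℝ) =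
      ∑ i, inner ℝ (f (x i, θ (x i)) - f (x i, θstar (x i))) (e i ω) := by
    simp [PiLp.inner_apply, w]
  rw [hinner] at hb
  refine hb.trans ?_
  have hsq : √(M₀ * 2 ^ j) ≤ 2 * √m := by
    refine Real.sqrt_le_iff.2 ⟨by positivity, ?_⟩
    rw [mul_pow, Real.sq_sqrt hm0.le]
    linarith
  calc σ * L * √(8 * Q) * (M₀ * 2 ^ j * √(M₀ * 2 ^ j) * H) / (1 - √h / 2)
      ≤ σ * L * √(8 * Q) * ((2 * m) * (2 * √m) * H) / (1 - √h / 2) := by gcongr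
    _ = _ := by ring

end EmpiricalProcess


/-! ### Deterministic inequalities -/

section Deterministic

/-- A quadratic inequality with a remainder of order `3/2` bounds both variables. -/
lemma exists_bound_of_quadratic {ω₀ l c₀ c K M₀ : ℝ} (hω₀ : 0 < ω₀) (hl : 0 < l) (hc₀ : 0 ≤ c₀)
    (hc : 0 ≤ c) (hM₀ : 1 ≤ M₀) :
    ∃ M : ℝ, 0 < M ∧ ∀ s R : ℝ, 0 ≤ s → 0 ≤ R →
      (∀ m, M₀ ≤ m → R ≤ m → s ≤ m → ω₀ * s ^ 2 + l * R ^ 2 ≤ c₀ + c * s + K * (m * √m)) →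
      s ≤ M ∧ R ≤ M := by
  set κ := min ω₀ l with hκ
  have hκ0 : 0 < κ := lt_min hω₀ hl
  refine ⟨max M₀ (((c₀ + c + K) / κ) ^ 2), by positivity, ?_⟩
  intro s R hs hR h
  -- If this maximum exceeds M₀, the left side is at least κ m² and the right side at most (c₀ + c +
  -- K) m^{3/2}, which bounds √m.
  set m := max M₀ (max s R) with hm
  have hsm : s ≤ m := (le_max_left _ _).trans (le_max_right _ _)
  have hRm : R ≤ m := (le_max_right _ _).trans (le_max_right _ _)
  have hMm : M₀ ≤ m := le_max_left _ _
  suffices m ≤ max M₀ (((c₀ + c + K) / κ) ^ 2) from ⟨hsm.trans this, hRm.trans this⟩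
  rcases le_total (max s R) M₀ with hle | hle
  · rw [hm, max_eq_left hle]
    exact le_max_left _ _
  refine le_max_of_le_right ?_
  have hm1 : 1 ≤ m := hM₀.trans hMm
  have h1 := h m hMm hRm hsm
  have h2 : κ * m ^ 2 ≤ ω₀ * s ^ 2 + l * R ^ 2 := by
    have e1 : m ^ 2 ≤ s ^ 2 + R ^ 2 := by
      rw [hm, max_eq_right hle]
      rcases max_choice s R with h | h <;> rw [h] <;> nlinarith
    calc κ * m ^ 2 ≤ κ * (s ^ 2 + R ^ 2) := by gcongr
      _ = κ * s ^ 2 + κ * R ^ 2 := by ring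
      _ ≤ _ := by
        gcongr
        · exact min_le_left _ _
        · exact min_le_right _ _
  have hsq : √m ^ 2 = m := Real.sq_sqrt (by linarith)
  have hs1 : 1 ≤ √m := Real.one_le_sqrt.2 hm1
  have h3 : κ * m ^ 2 ≤ (c₀ + c + K) * (m * √m) := by
    have e1 : c₀ ≤ c₀ * (m * √m) := le_mul_of_one_le_right hc₀ (by nlinarith)
    have e2 : c * s ≤ c * (m * √m) := by
      gcongr
      nlinarith
    linarith
  have h4 : κ * √m ≤ c₀ + c + K := by
    refine le_of_mul_le_mul_right ?_ (show 0 < m * √m by positivity)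
    calc κ * √m * (m * √m) = κ * (m * √m ^ 2) := by ring
      _ = κ * m ^ 2 := by rw [hsq]; ring
      _ ≤ _ := h3
  calc m = √m ^ 2 := hsq.symm
    _ ≤ ((c₀ + c + K) / κ) ^ 2 := by
      gcongr
      rw [le_div_iff₀ hκ0]
      linarith

/-- Excess squared loss after perturbing the model. -/
lemma excess_loss_ge {W : Type*} [NormedAddCommGroup W] [InnerProductSpace ℝ W]
    {z e u u' v v' : W} {A L η ω₀ D : ℝ}
    (hzu : ‖z - u‖ ≤ A) (huu : ‖u - u'‖ ≤ L * D) (hv : ‖v - u‖ ≤ η) (hv' : ‖v' - u'‖ ≤ η)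
    (hvv : ‖(v - u) - (v' - u')‖ ≤ η * D)
    (hid : ω₀ * D ^ 2 ≤ ‖z - u‖ ^ 2 - ‖z - u'‖ ^ 2) :
    ω₀ * D ^ 2 - 2 * (A + L + η) * η * D - 2 * inner ℝ (v - v') e ≤
      ‖z + e - v‖ ^ 2 - ‖z + e - v'‖ ^ 2 := by
  -- With v = u + δ and v' = u' + δ', the difference of squares expands into the unperturbed excess,
  -- the noise term, and three cross terms. Each cross term contains u - u' or δ - δ', hence a
  -- factor D; they account for A, L and η in the coefficient.
  obtain ⟨δ, rfl⟩ : ∃ δ, v = u + δ := ⟨v - u, by abel⟩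
  obtain ⟨δ', rfl⟩ : ∃ δ', v' = u' + δ' := ⟨v' - u', by abel⟩
  simp only [add_sub_cancel_left] at hv hv' hvv
  have hA : 0 ≤ A := (norm_nonneg _).trans hzu
  have i1 : inner ℝ (z - u) (δ - δ') ≤ A * (η * D) :=
    (real_inner_le_norm _ _).trans (mul_le_mul hzu hvv (norm_nonneg _) hA)
  have i2 : -(L * D * η) ≤ inner ℝ (u - u') δ' := by
    have := neg_le_of_abs_le (abs_real_inner_le_norm (u - u') δ')
    have h2 := mul_le_mul huu hv' (norm_nonneg _) ((norm_nonneg _).trans huu)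
    linarith
  have i3 : -(η * D * (η + η)) ≤ inner ℝ (δ - δ') (δ + δ') := by
    have := neg_le_of_abs_le (abs_real_inner_le_norm (δ - δ') (δ + δ'))
    have h2 := mul_le_mul hvv ((norm_add_le δ δ').trans (add_le_add hv hv')) (norm_nonneg _)
      ((norm_nonneg _).trans hvv)
    linarith
  have key : ‖z + e - (u + δ)‖ ^ 2 - ‖z + e - (u' + δ')‖ ^ 2 =
      ‖z - u‖ ^ 2 - ‖z - u'‖ ^ 2 - 2 * inner ℝ (z - u) (δ - δ') + 2 * inner ℝ (u - u') δ' +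
        inner ℝ (δ - δ') (δ + δ') - 2 * inner ℝ (u + δ - (u' + δ')) e := by
    simp only [← real_inner_self_eq_norm_sq, inner_add_left, inner_add_right, inner_sub_left,
      inner_sub_right]
    linarith [real_inner_comm z e, real_inner_comm z u, real_inner_comm z u',
      real_inner_comm z δ, real_inner_comm z δ', real_inner_comm e u, real_inner_comm e u',
      real_inner_comm e δ, real_inner_comm e δ', real_inner_comm u δ, real_inner_comm u' δ',
      real_inner_comm u δ', real_inner_comm u' δ, real_inner_comm δ δ']
  rw [key]
  nlinarith

variable {d q r : ℕ} {X : Set (EuclideanSpace ℝ (Fin d))} {Θ : Set (EuclideanSpace ℝ (Fin q))}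
  {Φ : X → X → ℝ} {P : Submodule ℝ (X → ℝ)}

/-- The basic inequality for the penalized least squares estimate. -/
lemma basic_inequality {n : ℕ} (hn : 1 ≤ n) {x : Fin n → X}
    {ζ : X → EuclideanSpace ℝ (Fin r)}
    {f g : EuclideanSpace ℝ (Fin d) × EuclideanSpace ℝ (Fin q) → EuclideanSpace ℝ (Fin r)}
    {e : Fin n → EuclideanSpace ℝ (Fin r)} {lam A L η ω₀ : ℝ} (hη : 0 ≤ η) (hL : 0 ≤ L)
    {θ θstar : X → EuclideanSpace ℝ (Fin q)} (hθstar : θstar ∈ nativeSpaceIn Φ P Θ)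
    (hest : IsEstimate Φ P Θ x (fun i => ζ (x i) + e i) f lam θ)
    (hA : ∀ z : X, ∀ t ∈ Θ, ‖ζ z - g (z, t)‖ ≤ A)
    (hg : ∀ z ∈ X, ∀ s ∈ Θ, ∀ t ∈ Θ, ‖g (z, s) - g (z, t)‖ ≤ L * ‖s - t‖)
    (hfg : ∀ z ∈ X, ∀ s ∈ Θ, ∀ t ∈ Θ, ‖f (z, s) - g (z, s)‖ ≤ η ∧
      ‖(f (z, s) - g (z, s)) - (f (z, t) - g (z, t))‖ ≤ η * ‖s - t‖)
    (hid : ∀ t ∈ Θ, ∀ z : X,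
      ω₀ * ‖t - θstar z‖ ^ 2 ≤ ‖ζ z - g (z, t)‖ ^ 2 - ‖ζ z - g (z, θstar z)‖ ^ 2) :
    ω₀ * ∑ i, ‖θ (x i) - θstar (x i)‖ ^ 2 + n * lam * nativeNormVec Φ P θ ^ 2 ≤
      n * lam * nativeNormVec Φ P θstar ^ 2 +
        2 * (A + L + η) * η * (√n * √(∑ i, ‖θ (x i) - θstar (x i)‖ ^ 2)) +
        2 * |∑ i, inner ℝ (f (x i, θ (x i)) - f (x i, θstar (x i))) (e i)| := by
  have hn0 : (0 : ℝ) < n := by exact_mod_cast hn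
  obtain ⟨hθ, hmin⟩ := hest
  have hcrit := hmin hθstar
  simp only [criterion, Set.mem_ofPred_eq, ← nativeNormVec_sq] at hcrit
  have hsum : ∑ i, (ω₀ * ‖θ (x i) - θstar (x i)‖ ^ 2 -
      2 * (A + L + η) * η * ‖θ (x i) - θstar (x i)‖ -
      2 * inner ℝ (f (x i, θ (x i)) - f (x i, θstar (x i))) (e i)) ≤
      ∑ i, (‖ζ (x i) + e i - f (x i, θ (x i))‖ ^ 2 -
        ‖ζ (x i) + e i - f (x i, θstar (x i))‖ ^ 2) := by
    refine Finset.sum_le_sum fun i _ => ?_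
    have h1 := hfg (x i) (x i).2 _ (hθ.2 (x i)) _ (hθstar.2 (x i))
    have h2 := hfg (x i) (x i).2 _ (hθstar.2 (x i)) _ (hθ.2 (x i))
    exact excess_loss_ge (hA _ _ (hθ.2 _)) (hg _ (x i).2 _ (hθ.2 _) _ (hθstar.2 _)) h1.1 h2.1
      h1.2 (hid _ (hθ.2 _) _)
  simp only [Finset.sum_sub_distrib, ← Finset.mul_sum] at hsum
  -- Cauchy–Schwarz turns the emulator error, linear in the increments, into a multiple of the root
  -- of the sum of squares.
  have hcs : ∑ i, ‖θ (x i) - θstar (x i)‖ ≤ √n * √(∑ i, ‖θ (x i) - θstar (x i)‖ ^ 2) := by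
    rw [← Real.sqrt_mul hn0.le]
    refine Real.le_sqrt_of_sq_le ?_
    simpa using sq_sum_le_card_mul_sum_sq (s := (Finset.univ : Finset (Fin n)))
      (f := fun i => ‖θ (x i) - θstar (x i)‖)
  have hcoef : 0 ≤ 2 * (A + L + η) * η := by
    have : 0 ≤ A := (norm_nonneg _).trans (hA (x ⟨0, hn⟩) _ (hθ.2 (x ⟨0, hn⟩)))
    positivity
  have hcs' := mul_le_mul_of_nonneg_left hcs hcoef
  have habs := le_abs_self (∑ i, inner ℝ (f (x i, θ (x i)) - f (x i, θstar (x i))) (e i))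
  have hcrit' := mul_le_mul_of_nonneg_left hcrit hn0.le
  have hscale : ∀ S T : ℝ, n * (1 / n * S + lam * T) = S + n * lam * T := fun S T => by
    field_simp
  rw [hscale, hscale] at hcrit'
  linarith

/-- `L₂` bound for vector-valued members of the native space by the design condition. -/
lemma l2NormVec_sub_le {n : ℕ} (hn : 1 ≤ n) {x : Fin n → X} {C a M : ℝ} (ha : 0 ≤ a)
    (hx : ∀ f ∈ nativeSpace Φ P,
      l2Norm f ≤ ENNReal.ofReal (C * (empNorm x f + a * nativeNorm Φ P f)))
    {θ θ' : X → EuclideanSpace ℝ (Fin q)} (hθ : θ ∈ nativeSpaceIn Φ P Θ)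
    (hθ' : θ' ∈ nativeSpaceIn Φ P Θ) (hM : 0 ≤ M)
    (hemp : √(∑ i, ‖θ (x i) - θ' (x i)‖ ^ 2) ≤ M * √(n * a ^ 2))
    (hR : nativeNormVec Φ P θ ≤ M) :
    l2NormVec (fun s => θ s - θ' s) ≤
      ENNReal.ofReal (q * (|C| * (2 * M + nativeNormVec Φ P θ')) * a) := by
  have hn0 : (0 : ℝ) < n := by exact_mod_cast hn
  have hR' : 0 ≤ nativeNormVec Φ P θ' := Real.sqrt_nonneg _
  set b := |C| * (2 * M + nativeNormVec Φ P θ') * a with hb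
  have hb0 : 0 ≤ b := by positivity
  have hj : ∀ j, l2Norm (fun s => (θ s - θ' s) j) ≤ ENNReal.ofReal b := by
    intro j
    obtain ⟨hmem, hle⟩ := nativeNorm_sub_le (hθ.1 j) (hθ'.1 j)
    refine (hx _ hmem).trans (ENNReal.ofReal_le_ofReal ?_)
    have h1 : empNorm x (fun s => θ s j - θ' s j) ≤ M * a := by
      refine Real.sqrt_le_iff.2 ⟨by positivity, ?_⟩
      rw [div_le_iff₀ hn0]
      calc ∑ i, (θ (x i) j - θ' (x i) j) ^ 2 ≤ ∑ i, ‖θ (x i) - θ' (x i)‖ ^ 2 := by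
            refine Finset.sum_le_sum fun i _ => ?_
            rw [← sq_abs (θ (x i) j - θ' (x i) j)]
            exact pow_le_pow_left₀ (abs_nonneg _) (abs_coord_le_norm (θ (x i) - θ' (x i)) j) 2
        _ ≤ (M * √(n * a ^ 2)) ^ 2 := by
            rw [← Real.sqrt_le_left (by positivity)]
            exact hemp
        _ = (M * a) ^ 2 * n := by
            rw [mul_pow, Real.sq_sqrt (by positivity)]
            ring
    have h2 : nativeNorm Φ P (fun s => θ s j - θ' s j) ≤ M + nativeNormVec Φ P θ' :=
      hle.trans (add_le_add ((nativeNorm_le_nativeNormVec θ j).trans hR)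
        (nativeNorm_le_nativeNormVec θ' j))
    have h3 : 0 ≤ empNorm x (fun s => θ s j - θ' s j) := Real.sqrt_nonneg _
    have h4 : 0 ≤ nativeNorm Φ P (fun s => θ s j - θ' s j) := nativeNorm_nonneg _
    calc C * (empNorm x (fun s => θ s j - θ' s j) +
          a * nativeNorm Φ P (fun s => θ s j - θ' s j))
        ≤ |C| * (M * a + a * (M + nativeNormVec Φ P θ')) := by
          refine mul_le_mul (le_abs_self C) ?_ (by positivity) (abs_nonneg C)
          gcongr
      _ = b := by rw [hb]; ring
  calc l2NormVec (fun s => θ s - θ' s) ≤ ((q * ENNReal.ofReal b) ^ 2) ^ (1 / 2 : ℝ) := by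
        refine ENNReal.rpow_le_rpow ?_ (by norm_num)
        calc ∑ j, l2Norm (fun s => (θ s - θ' s) j) ^ 2
            ≤ ∑ _j : Fin q, ENNReal.ofReal b ^ 2 := by
              gcongr with j
              exact hj j
          _ = q * ENNReal.ofReal b ^ 2 := by simp
          _ ≤ (q * ENNReal.ofReal b) ^ 2 := by
              rw [mul_pow]
              gcongr
              exact_mod_cast Nat.le_self_pow (by norm_num) q
    _ = q * ENNReal.ofReal b := by
        rw [← ENNReal.rpow_natCast, ← ENNReal.rpow_mul]
        norm_num
    _ = _ := by
        rw [← ENNReal.ofReal_natCast, ← ENNReal.ofReal_mul (by positivity)]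
        congr 1
        rw [hb]; ring

end Deterministic


/-! ### The high-probability bound for the estimate -/

section Rate

variable {Ω : Type*} [MeasurableSpace Ω] {μ : Measure Ω} [IsProbabilityMeasure μ]
  {d q r : ℕ} {X : Set (EuclideanSpace ℝ (Fin d))} {Θ : Set (EuclideanSpace ℝ (Fin q))}
  {Φ : X → X → ℝ} {P : Submodule ℝ (X → ℝ)}

/-- A continuously differentiable model on `X × Θ` is bounded, and Lipschitz in the parameter. -/
lemma exists_bounds_model (hXc : IsCompact X) (hXconv : Convex ℝ X) (hΘc : IsCompact Θ)
    (hΘ : LocallyQuasiconvex Θ)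
    {y : EuclideanSpace ℝ (Fin d) × EuclideanSpace ℝ (Fin q) → EuclideanSpace ℝ (Fin r)}
    (hy : ContDiffOn ℝ 1 y (X ×ˢ Θ)) :
    ∃ A L : ℝ, 0 ≤ L ∧ ∀ z ∈ X, ∀ s ∈ Θ, ‖y (z, s)‖ ≤ A ∧
      ∀ t ∈ Θ, ‖y (z, s) - y (z, t)‖ ≤ L * ‖s - t‖ := by
  obtain ⟨L, hL⟩ := (locallyLipschitzOn_of_contDiffOn hXconv hΘ hy).exists_lipschitzOnWith_of_compact
    (hXc.prod hΘc)
  obtain ⟨A, hA⟩ := (hXc.prod hΘc).exists_bound_of_continuousOn hy.continuousOn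
  refine ⟨A, L, L.2, fun z hz s hs => ⟨hA _ ⟨hz, hs⟩, fun t ht => ?_⟩⟩
  have := hL.dist_le_mul (z, s) ⟨hz, hs⟩ (z, t) ⟨hz, ht⟩
  rwa [Prod.dist_eq, dist_self, max_eq_right dist_nonneg, dist_eq_norm, dist_eq_norm] at this

/-- With large probability the estimate is bounded in the native semi-norm and close to
`θstar` at the design points. -/
lemma exists_event_estimate (hXc : IsCompact X) (hXconv : Convex ℝ X) (hΘc : IsCompact Θ)
    (hΘ : LocallyQuasiconvex Θ) {ζ : X → EuclideanSpace ℝ (Fin r)}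
    (hζ : ∃ M : ℝ, ∀ x, ‖ζ x‖ ≤ M)
    {y : EuclideanSpace ℝ (Fin d) × EuclideanSpace ℝ (Fin q) → EuclideanSpace ℝ (Fin r)}
    {yhat : ℕ → EuclideanSpace ℝ (Fin d) × EuclideanSpace ℝ (Fin q) → EuclideanSpace ℝ (Fin r)}
    {ν : ℝ} (hν : (d : ℝ) / 2 < ν) (x : (n : ℕ) → Fin n → X)
    {σ : ℝ} (hσ : 0 < σ) {e : (n : ℕ) → Fin n → Ω → EuclideanSpace ℝ (Fin r)}
    (he : NoiseCondition μ σ e) (hy : ContDiffOn ℝ 1 y (X ×ˢ Θ))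
    (hent : EntropyCondition Φ P d ν) (hemu : EmulatorCondition (X ×ˢ Θ) ν y yhat)
    {θstar : X → EuclideanSpace ℝ (Fin q)} (hθstar : θstar ∈ nativeSpaceIn Φ P Θ)
    (hid : IdentifiabilityCondition Θ ζ y θstar) {lam : ℕ → ℝ}
    (hlam_pos : ∀ n, 1 ≤ n → 0 < lam n)
    (hlam : lam =O[atTop] fun n : ℕ => (n : ℝ) ^ (-(2 * ν / (2 * ν + d))))
    (hlam_inv : (fun n => (lam n)⁻¹) =O[atTop] fun n : ℕ => (n : ℝ) ^ (2 * ν / (2 * ν + d)))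
    {ε : ℝ} (hε : 0 < ε) :
    ∃ M : ℝ, 0 < M ∧ ∀ᶠ n in atTop, ∃ bad : Set Ω, μ bad ≤ ENNReal.ofReal ε ∧
      ∀ ω ∉ bad, ∀ θ, IsEstimate Φ P Θ (x n) (fun i => ζ (x n i) + e n i ω) (yhat n) (lam n) θ →
        nativeNormVec Φ P θ ≤ M ∧ √(∑ i, ‖θ (x n i) - θstar (x n i)‖ ^ 2) ≤
          M * √(n * ((n : ℝ) ^ (-(ν / (2 * ν + d)))) ^ 2) := by
  have hν0 : 0 < ν := lt_of_le_of_lt (by positivity) hν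
  obtain ⟨Mζ, hMζ⟩ := hζ
  obtain ⟨Ay, Ly, hLy, hyb⟩ := exists_bounds_model hXc hXconv hΘc hΘ hy
  obtain ⟨A₁, hA₁, hc1⟩ := bounds_of_c1Norm_le (X := X) (r := r) hΘ
  obtain ⟨hyhat, C₁, hC₁⟩ := hemu
  obtain ⟨-, ω₀, hω₀, hmargin⟩ := hid
  obtain ⟨c₁, hc₁, hlam₁⟩ := hlam.exists_pos
  obtain ⟨c₂, hc₂, hlam₂⟩ := hlam_inv.exists_pos
  set cη := A₁ * |C₁| with hcη
  have hcη0 : 0 ≤ cη := by positivity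
  set Rs := nativeNormVec Φ P θstar with hRs
  have hRs0 : 0 ≤ Rs := Real.sqrt_nonneg _
  obtain ⟨K, hK0, hK⟩ := exists_event_process (μ := μ) (r := r) hν hent hσ
    (L := Ly + cη + 1) (by positivity) hθstar (M₀ := 1) le_rfl hε
  set cs := 2 * (|Mζ| + |Ay| + Ly + cη) * cη with hcs
  -- These are the coefficients of the basic inequality divided by H = n a²: nλ lies between H/c₂
  -- and c₁ H, and √n a = √H absorbs the emulator error into `cs`. Hence M is fixed before n.
  obtain ⟨M, hM0, hM⟩ := exists_bound_of_quadratic (ω₀ := ω₀) (l := 1 / c₂) (c₀ := c₁ * Rs ^ 2)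
    (c := cs) (K := 2 * K) (M₀ := 1) hω₀ (by positivity) (by positivity) (by positivity) le_rfl
  refine ⟨M, hM0, ?_⟩
  filter_upwards [hC₁, hlam₁.bound, hlam₂.bound, eventually_ge_atTop 1] with n hn₁ hn₂ hn₃ hn
  have hn0 : (0 : ℝ) < n := by exact_mod_cast hn
  set a : ℝ := (n : ℝ) ^ (-(ν / (2 * ν + d))) with ha
  have ha0 : 0 < a := by positivity
  have ha1 : a ≤ 1 := Real.rpow_le_one_of_one_le_of_nonpos (by exact_mod_cast hn)
    (by rw [neg_nonpos]; positivity)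
  have ha2 : (n : ℝ) ^ (-(2 * ν / (2 * ν + d))) = a ^ 2 := by
    rw [ha, ← Real.rpow_natCast, ← Real.rpow_mul hn0.le]
    congr 1
    push_cast
    ring
  have ha2' : (n : ℝ) ^ (2 * ν / (2 * ν + d)) = (a ^ 2)⁻¹ := by
    rw [← ha2, Real.rpow_neg hn0.le, inv_inv]
  have hl0 := hlam_pos n hn
  have hl₁ : lam n ≤ c₁ * a ^ 2 := by
    rw [ha2, Real.norm_of_nonneg hl0.le, Real.norm_of_nonneg (by positivity)] at hn₂
    exact hn₂
  have hl₂ : 1 / c₂ * a ^ 2 ≤ lam n := by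
    rw [ha2', Real.norm_of_nonneg (by positivity), Real.norm_of_nonneg (by positivity)] at hn₃
    rw [← inv_inv (lam n)]
    calc 1 / c₂ * a ^ 2 = (c₂ * (a ^ 2)⁻¹)⁻¹ := by rw [mul_inv, inv_inv, one_div]
      _ ≤ _ := inv_anti₀ (by positivity) hn₃
  set H : ℝ := n * a ^ 2 with hH
  have hH0 : 0 < H := by positivity
  have hnH : √n * a = √H := by rw [hH, Real.sqrt_mul hn0.le, Real.sqrt_sq ha0.le]
  have hemub : ∀ z ∈ X, ∀ s ∈ Θ, ∀ t ∈ Θ, ‖yhat n (z, s) - y (z, s)‖ ≤ cη * a ∧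
      ‖(yhat n (z, s) - y (z, s)) - (yhat n (z, t) - y (z, t))‖ ≤ cη * a * ‖s - t‖ := by
    intro z hz s hs t ht
    have := hc1 (fun p => yhat n p - y p) ((hyhat n).sub hy) (|C₁| * a) (by positivity)
      (hn₁.trans (ENNReal.ofReal_le_ofReal (by gcongr; exact le_abs_self _))) z hz s hs t ht
    rwa [← mul_assoc] at this
  have hlip : ∀ z ∈ X, ∀ s ∈ Θ, ∀ t ∈ Θ,
      ‖yhat n (z, s) - yhat n (z, t)‖ ≤ (Ly + cη + 1) * ‖s - t‖ := by
    intro z hz s hs t ht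
    have h1 := (hemub z hz s hs t ht).2
    have h2 := (hyb z hz s hs).2 t ht
    have h3 : cη * a * ‖s - t‖ ≤ cη * ‖s - t‖ := by
      gcongr
      exact mul_le_of_le_one_right hcη0 ha1
    have h4 : yhat n (z, s) - yhat n (z, t) =
        ((yhat n (z, s) - y (z, s)) - (yhat n (z, t) - y (z, t))) + (y (z, s) - y (z, t)) := by
      abel
    rw [h4]
    refine (norm_add_le _ _).trans ?_
    linarith [norm_nonneg (s - t)]
  obtain ⟨bad, hbad, hgood⟩ := hK n hn (x n) (e n) (he.indep n) (he.mean_zero n)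
    (he.subGaussian n) (yhat n) hlip
  refine ⟨bad, hbad, fun ω hω θ hθ => ?_⟩
  have hbasic := basic_inequality (g := y) hn (A := |Mζ| + |Ay|) (L := Ly) (η := cη * a)
    (ω₀ := ω₀) (by positivity) hLy hθstar hθ
    (fun z t ht => (norm_sub_le _ _).trans (add_le_add ((hMζ z).trans (le_abs_self _))
      ((hyb z z.2 t ht).1.trans (le_abs_self _))))
    (fun z hz s hs t ht => (hyb z hz s hs).2 t ht) hemub hmargin
  set R := nativeNormVec Φ P θ with hR
  have hR0 : 0 ≤ R := Real.sqrt_nonneg _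
  set s := √(∑ i, ‖θ (x n i) - θstar (x n i)‖ ^ 2) with hs
  have hs0 : 0 ≤ s := Real.sqrt_nonneg _
  have hs2 : ∑ i, ‖θ (x n i) - θstar (x n i)‖ ^ 2 = s ^ 2 :=
    (Real.sq_sqrt (Finset.sum_nonneg fun _ _ => sq_nonneg _)).symm
  rw [hs2] at hbasic
  have hsH0 : 0 < √H := Real.sqrt_pos.2 hH0
  have hsH : √H ^ 2 = H := Real.sq_sqrt hH0.le
  obtain ⟨h1, h2⟩ := hM (s / √H) R (by positivity) hR0 fun m hm hRm hsm => by
    have hproc := hgood ω hω θ hθ.1 m hm hRm (by rwa [div_le_iff₀ hsH0] at hsm)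
    refine le_of_mul_le_mul_right ?_ hH0
    have e1 : (s / √H) ^ 2 * H = s ^ 2 := by rw [div_pow, hsH]; field_simp
    have e2 : s / √H * H = √H * s := by
      nth_rewrite 2 [← hsH]
      field_simp
    have e3 : 1 / c₂ * R ^ 2 * H ≤ n * lam n * R ^ 2 := by
      calc 1 / c₂ * R ^ 2 * H = n * (1 / c₂ * a ^ 2) * R ^ 2 := by rw [hH]; ring
        _ ≤ _ := by gcongr
    have e4 : n * lam n * Rs ^ 2 ≤ c₁ * Rs ^ 2 * H := by
      calc n * lam n * Rs ^ 2 ≤ n * (c₁ * a ^ 2) * Rs ^ 2 := by gcongr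
        _ = _ := by rw [hH]; ring
    have e5 : 2 * (|Mζ| + |Ay| + Ly + cη * a) * (cη * a) * (√n * s) ≤ cs * (√H * s) := by
      have hca : cη * a ≤ cη := mul_le_of_le_one_right hcη0 ha1
      calc 2 * (|Mζ| + |Ay| + Ly + cη * a) * (cη * a) * (√n * s)
          = 2 * (|Mζ| + |Ay| + Ly + cη * a) * cη * ((√n * a) * s) := by ring
        _ ≤ 2 * (|Mζ| + |Ay| + Ly + cη) * cη * ((√n * a) * s) := by gcongr
        _ = _ := by rw [hnH]
    calc (ω₀ * (s / √H) ^ 2 + 1 / c₂ * R ^ 2) * H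
        = ω₀ * ((s / √H) ^ 2 * H) + 1 / c₂ * R ^ 2 * H := by ring
      _ ≤ c₁ * Rs ^ 2 * H + cs * (√H * s) + 2 * (K * (m * √m) * H) := by
          rw [e1]; linarith
      _ = (c₁ * Rs ^ 2 + cs * (s / √H) + 2 * K * (m * √m)) * H := by
          rw [← e2]; ring
  exact ⟨h2, by rwa [div_le_iff₀ hsH0] at h1⟩

end Rate

end FunCalib

/-! ### The convergence rates -/

theorem theorem4 {Ω : Type*} [MeasurableSpace Ω] (μ : Measure Ω) [IsProbabilityMeasure μ]
    (d q r : ℕ) (hd : 1 ≤ d)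
    -- the input domain and the parameter set
    (X : Set (EuclideanSpace ℝ (Fin d))) (hXc : IsCompact X) (hXconv : Convex ℝ X)
    (Θ : Set (EuclideanSpace ℝ (Fin q))) (hΘc : IsCompact Θ)
    (hΘ : FunCalib.LocallyQuasiconvex Θ)
    -- the kernel and its native space
    (Φ : X → X → ℝ) (P : Submodule ℝ (X → ℝ)) (hΦ : FunCalib.IsCondPosDef Φ P)
    -- the physical response, the computer model and its emulators
    (ζ : X → EuclideanSpace ℝ (Fin r)) (hζ : ∃ M : ℝ, ∀ x, ‖ζ x‖ ≤ M)
    (y : EuclideanSpace ℝ (Fin d) × EuclideanSpace ℝ (Fin q) → EuclideanSpace ℝ (Fin r))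
    (yhat : ℕ → EuclideanSpace ℝ (Fin d) × EuclideanSpace ℝ (Fin q) →
      EuclideanSpace ℝ (Fin r))
    (ν : ℝ) (hν : (d : ℝ) / 2 < ν)
    -- fixed design and noise
    (x : (n : ℕ) → Fin n → X) (hx : FunCalib.DesignCondition Φ P ν x)
    (σ : ℝ) (hσ : 0 < σ) (e : (n : ℕ) → Fin n → Ω → EuclideanSpace ℝ (Fin r))
    (he : FunCalib.NoiseCondition μ σ e)
    -- smoothness of the computer model
    (hy : ContDiffOn ℝ 2 y (X ×ˢ Θ))
    -- entropy of the native space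
    (hent : FunCalib.EntropyCondition Φ P d ν)
    -- accuracy of the emulators
    (hemu : FunCalib.EmulatorCondition (X ×ˢ Θ) ν y yhat)
    -- the optimal calibration function and its identifiability
    (θstar : X → EuclideanSpace ℝ (Fin q))
    (hθstar : θstar ∈ FunCalib.nativeSpaceIn Φ P Θ)
    (hid : FunCalib.IdentifiabilityCondition Θ ζ y θstar)
    -- the smoothing parameters
    (lam : ℕ → ℝ) (hlam_pos : ∀ n, 1 ≤ n → 0 < lam n)
    (hlam : lam =O[atTop] fun n : ℕ => (n : ℝ) ^ (-(2 * ν / (2 * ν + d))))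
    (hlam_inv : (fun n => (lam n)⁻¹) =O[atTop] fun n : ℕ => (n : ℝ) ^ (2 * ν / (2 * ν + d)))
    -- the estimator, computed from the observations `ζ (x_i) + e_i`
    (θhat : ℕ → Ω → X → EuclideanSpace ℝ (Fin q))
    (hθhat : ∀ n, 1 ≤ n → ∀ᵐ ω ∂μ,
      FunCalib.IsEstimate Φ P Θ (x n) (fun i => ζ (x n i) + e n i ω) (yhat n) (lam n)
        (θhat n ω)) :
    FunCalib.IsBigOp μ (fun n ω => FunCalib.l2NormVec fun s => θhat n ω s - θstar s)
        (fun n => (n : ℝ) ^ (-(ν / (2 * ν + d)))) ∧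
      FunCalib.IsBigOp μ
        (fun n ω => ENNReal.ofReal (FunCalib.nativeNormVec Φ P (θhat n ω)))
        (fun _ => 1) := by
  have main := fun {ε : ℝ} (hε : 0 < ε) => FunCalib.exists_event_estimate hXc hXconv hΘc hΘ hζ hν x
    hσ he (hy.of_le (by norm_num)) hent hemu hθstar hid hlam_pos hlam hlam_inv hε
  obtain ⟨Cx, hCx⟩ := hx
  have hRs : 0 ≤ FunCalib.nativeNormVec Φ P θstar := Real.sqrt_nonneg _
  refine ⟨fun ε hε => ?_, fun ε hε => ?_⟩
  · obtain ⟨M, hM, h⟩ := main hε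
    refine ⟨q * (|Cx| * (2 * M + FunCalib.nativeNormVec Φ P θstar)) + 1, by positivity, ?_⟩
    filter_upwards [h, eventually_ge_atTop 1] with n hbad hn
    obtain ⟨bad, hμ, hgood⟩ := hbad
    -- The exceptional set was chosen for all estimates at once, so almost everywhere inclusion
    -- suffices and θ̂ may depend on ω in any, even non-measurable, way.
    refine le_trans (measure_mono_ae ?_) hμ
    filter_upwards [hθhat n hn] with ω hω hlt
    by_contra hωb
    obtain ⟨h1, h2⟩ := hgood ω hωb _ hω
    refine absurd hlt (not_lt.2 ((FunCalib.l2NormVec_sub_le hn (by positivity) (hCx n hn) hω.1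
      hθstar hM.le h2 h1).trans (ENNReal.ofReal_le_ofReal ?_)))
    gcongr
    linarith
  · obtain ⟨M, hM, h⟩ := main hε
    refine ⟨M, hM, ?_⟩
    filter_upwards [h, eventually_ge_atTop 1] with n hbad hn
    obtain ⟨bad, hμ, hgood⟩ := hbad
    refine le_trans (measure_mono_ae ?_) hμ
    filter_upwards [hθhat n hn] with ω hω hlt
    by_contra hωb
    refine absurd hlt (not_lt.2 (ENNReal.ofReal_le_ofReal ?_))
    rw [mul_one]
    exact (hgood ω hωb _ hω).1
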